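/- Let $d$ be a dimension, let $\alpha\in(-\tfrac12,\infty)^d$ and let $\beta,\lambda>0$. Let $$d\mu_\alpha(x)=\prod_{i=1}^d\frac{x_i^{\alpha_i}e^{-x_i}}{\Gamma(\alpha_i+1)}\,dx\quad\text{on }(0,\infty)^d .$$ Let $L_k^\alpha(x)=\prod_{i}L_{k_i}^{\alpha_i}(x_i)$, $k\in\mathbb N^d$, be the Laguerre polynomials, where $L_m^a(x)=\frac1{m!}e^xx^{-a}\frac{d^m}{dx^m}(e^{-x}x^{m+a})$. They form an orthogonal basis of $L^2(\mu_\alpha)$ and are the eigenfunctions of the self-adjoint Laguerre operator $\mathcal L_\alpha$ (the closure of $-\sum_i[x_i\partial_i^2+(\alpha_i+1-x_i)\partial_i]$), with $\mathcal L_\alpha L_k^\alpha=|k|L_k^\alpha$, $|k|=k_1+\dots+k_d$. For a bounded sequence $m$, $m(\mathcal L_\alpha)$ is the bounded operator on $L^2(\mu_\alpha)$ with $m(\mathcal L_\alpha)L_k^\alpha=m(|k|)L_k^\alpha$. For $t>0$ let $T_t^\alpha f(x)=\int G_t^\alpha(x,y)f(y)\,d\mu_\alpha(y)$, where $$G_t^\alpha(x,y)=\prod_{j=1}^d\frac{\Gamma(\alpha_j+1)}{1-e^{-t}}\,e^{-\frac{e^{-t}}{1-e^{-t}}(x_j+y_j)}\,\sqrt{e^{-t}x_jy_j}^{\,-\alpha_j}\,I_{\alpha_j}\!\Big(\frac{2\sqrt{e^{-t}x_jy_j}}{1-e^{-t}}\Big)$$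 and $I_\nu$ is the modified Bessel function of the first kind, and let $$P_t^\alpha f(x)=\frac1{\sqrt\pi}\int_0^\infty\frac{e^{-u}}{\sqrt u}\,T^\alpha_{t^2/(4u)}f(x)\,du .$$ For $\gamma>0$ let $n$ be the smallest integer greater than $\gamma$. A (real-valued) function $f\in L^\infty(\mu_\alpha)$ belongs to $Lip_\gamma(\mu_\alpha)$ if there is $A\ge0$ with $\|\partial_t^nP_t^\alpha f\|_\infty\le A\,t^{-n+\gamma}$ for all $t>0$. Its norm is $\|f\|_{Lip_\gamma(\mu_\alpha)}=\|f\|_\infty+A_\gamma(f)$, with $A_\gamma(f)$ the smallest such $A$. (i) The Bessel–Laguerre potential $\mathcal J_\lambda^\alpha=(I+\mathcal L_\alpha)^{-\lambda/2}$, that is, $\mathcal J_\lambda^\alpha L_k^\alpha=(1+|k|)^{-\lambda/2}L_k^\alpha$, is bounded from $Lip_\beta(\mu_\alpha)$ to $Lip_{\beta+\lambda}(\mu_\alpha)$: there is a constant $C=C(d,\alpha,\beta,\lambda)$ such that, for every $f\in Lip_\beta(\mu_\alpha)$, $\mathcal J_\lambda^\alpha f\in Lip_{\beta+\lambda}(\mu_\alpha)$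 and $$\|\mathcal J_\lambda^\alpha f\|_{Lip_{\beta+\lambda}(\mu_\alpha)}\le C\,\|f\|_{Lip_\beta(\mu_\alpha)} .$$ (ii) The same holds for the operator $$\widetilde{\mathcal J}_\lambda^\alpha f(x)=\frac1{\Gamma(\lambda)}\int_0^\infty s^{\lambda-1}e^{-s}P_s^\alpha f(x)\,ds .$$ For every $f\in Lip_\beta(\mu_\alpha)$ this integral converges absolutely for almost every $x$, and it realises $(I+\sqrt{\mathcal L_\alpha})^{-\lambda}f$, that is, the multiplier $(1+\sqrt{|k|})^{-\lambda}$. Moreover $\widetilde{\mathcal J}_\lambda^\alpha f\in Lip_{\beta+\lambda}(\mu_\alpha)$ and $\|\widetilde{\mathcal J}_\lambda^\alpha f\|_{Lip_{\beta+\lambda}(\mu_\alpha)}\le C\,\|f\|_{Lip_\beta(\mu_\alpha)}$ with $C=C(d,\alpha,\beta,\lambda)$. -/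

import Mathlib

open MeasureTheory

/-- One-dimensional Laguerre polynomial of type `a` and degree `k` at `x > 0`, by Rodrigues' formula
`L_k^a(x) = (1 / k!) e^x x^{-a} (d/dx)^k (e^{-x} x^{k+a})`. -/
noncomputable def laguerrePoly (a : ℝ) (k : ℕ) (x : ℝ) : ℝ :=
  1 / (k.factorial : ℝ) * Real.exp x * x ^ (-a) *
    iteratedDeriv k (fun y : ℝ => Real.exp (-y) * y ^ ((k : ℝ) + a)) x

/-- `d`-dimensional Laguerre polynomial: tensor product of one-dimensional ones. -/
noncomputable def laguerrePolyProd {d : ℕ} (α : Fin d → ℝ) (k : Fin d → ℕ) (x : Fin d → ℝ) : ℝ :=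
  ∏ i, laguerrePoly (α i) (k i) (x i)

/-- The Laguerre measure on `(0,∞)^d`, seen as a measure on `ℝ^d` carried by `(0,∞)^d`: the product
of the Gamma laws with shape `α_i + 1` and rate `1`, that is, the measure with density
`∏ i, x_i ^ α_i * e^{-x_i} / Γ(α_i + 1)` on the positive orthant. -/
noncomputable def laguerreMeasure {d : ℕ} (α : Fin d → ℝ) : Measure (Fin d → ℝ) :=
  Measure.pi fun i => ProbabilityTheory.gammaMeasure (α i + 1) 1

/-- Modified Bessel function of the first kind `I_ν(z)`, for `z > 0`. -/
noncomputable def besselI (ν z : ℝ) : ℝ :=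
  ∑' m : ℕ, (z / 2) ^ (2 * (m : ℝ) + ν) / ((m.factorial : ℝ) * Real.Gamma ((m : ℝ) + ν + 1))

/-- The Laguerre heat kernel `G_t^α(x,y)` with respect to the Laguerre measure, for `t > 0`. -/
noncomputable def laguerreHeatKernel {d : ℕ} (α : Fin d → ℝ) (t : ℝ) (x y : Fin d → ℝ) : ℝ :=
  ∏ j, Real.Gamma (α j + 1) / (1 - Real.exp (-t)) *
    Real.exp (-(Real.exp (-t) / (1 - Real.exp (-t))) * (x j + y j)) *
    √(Real.exp (-t) * x j * y j) ^ (-α j) *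
    besselI (α j) (2 * √(Real.exp (-t) * x j * y j) / (1 - Real.exp (-t)))

/-- The Laguerre semigroup `T_t^α f(x)`, for `t > 0`. -/
noncomputable def laguerreHeat {d : ℕ} (α : Fin d → ℝ) (t : ℝ) (f : (Fin d → ℝ) → ℝ)
    (x : Fin d → ℝ) : ℝ :=
  ∫ y, laguerreHeatKernel α t x y * f y ∂(laguerreMeasure α)

/-- The Poisson-Laguerre semigroup `P_t^α f(x)`, for `t > 0`, subordinated to the heat semigroup. -/
noncomputable def laguerrePoisson {d : ℕ} (α : Fin d → ℝ) (t : ℝ) (f : (Fin d → ℝ) → ℝ)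
    (x : Fin d → ℝ) : ℝ :=
  1 / √Real.pi *
    ∫ u in Set.Ioi (0 : ℝ), Real.exp (-u) / √u * laguerreHeat α (t ^ 2 / (4 * u)) f x

/-- The smallest integer strictly greater than `β` (for `β ≥ 0`). -/
noncomputable def lipOrder (β : ℝ) : ℕ := ⌊β⌋₊ + 1

/-- `A` is an admissible constant in the Lipschitz condition of order `β`: with `n` the smallest
integer greater than `β`, `‖∂_t^n P_t^α f‖_∞ ≤ A t^{-n+β}` for all `t > 0`. -/
def LaguerreLipBound {d : ℕ} (α : Fin d → ℝ) (β : ℝ) (f : (Fin d → ℝ) → ℝ) (A : ℝ) : Prop :=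
  0 ≤ A ∧ ∀ t : ℝ, 0 < t →
    eLpNorm (fun x => iteratedDeriv (lipOrder β) (fun s => laguerrePoisson α s f x) t) ⊤
        (laguerreMeasure α)
      ≤ ENNReal.ofReal (A * t ^ (-(lipOrder β : ℝ) + β))

/-- Membership in the Laguerre Lipschitz space `Lip_β(μ_α)`. -/
def MemLaguerreLip {d : ℕ} (α : Fin d → ℝ) (β : ℝ) (f : (Fin d → ℝ) → ℝ) : Prop :=
  MemLp f ⊤ (laguerreMeasure α) ∧ ∃ A : ℝ, LaguerreLipBound α β f A

/-- The norm of `Lip_β(μ_α)`: the essential supremum of `|f|` plus the smallest admissible constant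
(the infimum below is attained for `f` in the space). -/
noncomputable def laguerreLipNorm {d : ℕ} (α : Fin d → ℝ) (β : ℝ) (f : (Fin d → ℝ) → ℝ) : ℝ :=
  (eLpNorm f ⊤ (laguerreMeasure α)).toReal + sInf {A : ℝ | LaguerreLipBound α β f A}

/-- `g = m(L_α) f` in `L²(μ_α)`, where `L_α` is the self-adjoint Laguerre operator, whose
eigenfunctions are the Laguerre polynomials, `L_α L_k^α = |k| L_k^α` with `|k| = k_1 + ⋯ + k_d`: the
Laguerre coefficient of `g` of index `k` is `m |k|` times that of `f`. The Laguerre polynomials being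
an orthogonal basis of `L²(μ_α)`, this determines `g` up to equality almost everywhere. -/
def IsLaguerreMultiplier {d : ℕ} (α : Fin d → ℝ) (m : ℕ → ℝ) (f g : (Fin d → ℝ) → ℝ) : Prop :=
  MemLp g 2 (laguerreMeasure α) ∧
    ∀ k : Fin d → ℕ,
      ∫ x, g x * laguerrePolyProd α k x ∂(laguerreMeasure α) =
        m (∑ i, k i) * ∫ x, f x * laguerrePolyProd α k x ∂(laguerreMeasure α)

/-- `g = (I + L_α)^{-lam/2} f`, the Bessel-Laguerre potential of order `lam` of `f ∈ L²(μ_α)`. -/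
def IsBesselLaguerrePotential {d : ℕ} (α : Fin d → ℝ) (lam : ℝ) (f g : (Fin d → ℝ) → ℝ) : Prop :=
  IsLaguerreMultiplier α (fun n => (1 + (n : ℝ)) ^ (-lam / 2)) f g

/-- The operator `(1 / Γ(lam)) ∫_0^∞ s^{lam-1} e^{-s} P_s^α f(x) ds`. -/
noncomputable def poissonBesselPotential {d : ℕ} (α : Fin d → ℝ) (lam : ℝ) (f : (Fin d → ℝ) → ℝ)
    (x : Fin d → ℝ) : ℝ :=
  1 / Real.Gamma lam *
    ∫ s in Set.Ioi (0 : ℝ), s ^ (lam - 1) * Real.exp (-s) * laguerrePoisson α s f x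

/-!
# Bessel potentials on Laguerre Lipschitz spaces

Everything is read off Laguerre coefficients `⟨f, L_k⟩ = ∫ f L_k dμ_α`. These determine a function
of `L²(μ_α)` (`ae_eq_of_coeff_eq`), because the moments determine a measure with exponential
moments. Expanding the Bessel function in the heat kernel shows that `T_t` preserves sup bounds and
multiplies the coefficient of index `k` by `e^{-t|k|}` (`coeff_laguerreHeat`). By subordination
(`subord_exp`, `coeff_poissonDeriv`), `∂_t^j P_t` has norm at most `C_j t^{-j}` on `L^∞` and
multiplies it by `(-√|k|)^j e^{-t√|k|}`. No semigroup law is needed: it is an identity between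
symbols, and comparing coefficients replaces it. For instance a bound `A t^{-k+β}` for the `k`-th
derivative implies one for each later derivative (`abs_poissonDeriv_le_of_le`).

Both potentials are functions of `ξ = √L_α` whose symbol is, for `ξ > 0`, a Laplace transform
`∫_0^∞ κ(s) e^{-sξ} ds` with `|κ(s)| ≤ B s^{lam-1}`. Hence, with `n > β + lam`,
`∂_t^n P_t g = ∫_0^∞ κ(s) ∂_t^n P_{t+s} f ds`, which is bounded by a multiple of
`∫_0^∞ s^{lam-1} (t+s)^{-n+β} ds = c t^{-n+β+lam}` (`laguerreLipBound_of_multiplier`); the value of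
the symbol at `ξ = 0` is irrelevant since the derivative `∂_t^n` annihilates constants. For
`(1+ξ)^{-lam}` the kernel is `s^{lam-1} e^{-s} / Γ(lam)`. For `(1+ξ²)^{-lam/2}` one factors
`1+ξ² = (ξ+i)(ξ-i)`, so that `κ` is the convolution of `s^{lam/2-1} e^{∓is} / Γ(lam/2)`, dominated
by that of `s^{lam/2-1} / Γ(lam/2)` with itself, which is a multiple of `s^{lam-1}`
(`abs_besselKernel_le`, `laplace_besselKernel`).
-/

namespace Laguerre
open Real Set Filter Topology

/-! ### The explicit form of the Laguerre polynomials -/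

lemma add_one_pos {a : ℝ} (ha : -1 < a) (n : ℕ) : 0 < (n : ℝ) + a + 1 := by
  have : (0 : ℝ) ≤ n := n.cast_nonneg
  linarith

lemma Gamma_add_one_pos {a : ℝ} (ha : -1 < a) (n : ℕ) : 0 < Gamma ((n : ℝ) + a + 1) :=
  Gamma_pos_of_pos (add_one_pos ha n)

lemma Gamma_succ_add {a : ℝ} (ha : -1 < a) (n : ℕ) :
    Gamma (((n + 1 : ℕ) : ℝ) + a + 1) = ((n : ℝ) + a + 1) * Gamma ((n : ℝ) + a + 1) := by
  rw [← Real.Gamma_add_one (add_one_pos ha n).ne']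
  congr 1
  push_cast
  ring

lemma descPochhammer_eval_add {b : ℝ} (hb : -1 < b) (n : ℕ) :
    (descPochhammer ℝ n).eval (n + b) = Gamma (n + b + 1) / Gamma (b + 1) := by
  induction n with
  | zero =>
    have := (Gamma_add_one_pos hb 0).ne'
    simp only [CharP.cast_eq_zero, zero_add] at this
    simp [this]
  | succ n ih =>
    rw [descPochhammer_succ_left, Gamma_succ_add hb]
    simp only [Polynomial.eval_mul, Polynomial.eval_X, Polynomial.eval_comp, Polynomial.eval_sub,
      Polynomial.eval_one]
    have : ((n + 1 : ℕ) : ℝ) + b - 1 = n + b := by push_cast; ring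
    rw [this, ih]
    push_cast
    ring

lemma iteratedDeriv_exp_neg (n : ℕ) (x : ℝ) :
    iteratedDeriv n (fun y : ℝ => Real.exp (-y)) x = (-1) ^ n * Real.exp (-x) := by
  have := iteratedDeriv_comp_neg n Real.exp x
  rw [this, iteratedDeriv_eq_iterate, Real.iter_deriv_exp]
  simp

/-- The power expansion of the Laguerre polynomials, from Leibniz' rule in Rodrigues' formula. -/
lemma laguerrePoly_eq {a : ℝ} (ha : -1 < a) (k : ℕ) {x : ℝ} (hx : 0 < x) :
    laguerrePoly a k x = Gamma (k + a + 1) / k.factorial *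
      ∑ n ∈ Finset.range (k + 1), (-1) ^ n * (k.choose n) / Gamma (n + a + 1) * x ^ n := by
  unfold laguerrePoly
  have h1 : ContDiffAt ℝ k (fun y : ℝ => Real.exp (-y)) x := by fun_prop
  have h2 : ContDiffAt ℝ k (fun y : ℝ => y ^ ((k : ℝ) + a)) x :=
    Real.contDiffAt_rpow_const_of_ne hx.ne'
  rw [iteratedDeriv_fun_mul h1 h2, Finset.mul_sum, Finset.mul_sum]
  refine Finset.sum_congr rfl fun n hn => ?_
  have hn' : n ≤ k := Nat.lt_succ_iff.mp (Finset.mem_range.mp hn)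
  rw [iteratedDeriv_exp_neg, iteratedDeriv_eq_iterate, Real.iter_deriv_rpow_const]
  have e1 : (k : ℝ) + a = ((k - n : ℕ) : ℝ) + (n + a) := by
    rw [Nat.cast_sub hn']; ring
  have hb : -1 < (n : ℝ) + a := by
    have : (0 : ℝ) ≤ n := n.cast_nonneg
    linarith
  have e2 : (k : ℝ) + a - ((k - n : ℕ) : ℝ) = n + a := by
    rw [Nat.cast_sub hn']; ring
  rw [e2]
  nth_rewrite 1 [e1]
  rw [descPochhammer_eval_add hb, ← e1]
  have e3 : ((k - n : ℕ) : ℝ) + ((n : ℝ) + a) + 1 = k + a + 1 := by rw [← e1]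
  rw [Real.rpow_add hx, Real.rpow_natCast, Real.rpow_neg hx.le, Real.exp_neg]
  have := Real.exp_pos x
  have h4 := Real.rpow_pos_of_pos hx a
  field_simp

/-- The binomial identity behind both the eigenfunction relation (`r = e^{-t}`) and the
inversion of the Laguerre expansion (`r = 0`). -/
lemma sum_choose_mul_choose (k j : ℕ) (r : ℝ) (hj : j ≤ k) :
    ∑ n ∈ Finset.range (k + 1), (-1 : ℝ) ^ n * k.choose n * n.choose j * (1 - r) ^ (n - j) =
      (-1) ^ j * k.choose j * r ^ (k - j) := by
  obtain ⟨m, rfl⟩ := Nat.exists_eq_add_of_le hj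
  rw [show j + m + 1 = j + (m + 1) by ring, Finset.sum_range_add,
    Finset.sum_eq_zero (s := Finset.range j), zero_add]
  · have : r ^ (j + m - j) = (-(1 - r) + 1) ^ m := by
      rw [Nat.add_sub_cancel_left]; congr 1; ring
    rw [this, add_pow, Finset.mul_sum]
    refine Finset.sum_congr rfl fun i hi => ?_
    have hi' : i ≤ m := Nat.lt_succ_iff.mp (Finset.mem_range.mp hi)
    have h := Nat.choose_mul (n := j + m) (k := j + i) (s := j) (by omega)
    simp only [Nat.add_sub_cancel_left] at h ⊢
    have h' : ((j + m).choose (j + i) : ℝ) * (j + i).choose j = (j + m).choose j * m.choose i := by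
      exact_mod_cast h
    rw [mul_assoc ((-1) ^ (j + i)), h', pow_add, neg_pow (1 - r)]
    simp
    ring
  · intro n hn
    rw [Nat.choose_eq_zero_of_lt (Finset.mem_range.mp hn)]
    simp

/-- Monomials are combinations of Laguerre polynomials. -/
lemma pow_eq_sum_laguerrePoly {a : ℝ} (ha : -1 < a) (n : ℕ) {x : ℝ} (hx : 0 < x) :
    x ^ n = ∑ k ∈ Finset.range (n + 1), (-1) ^ k * n.choose k * Gamma (n + a + 1) *
      k.factorial / Gamma (k + a + 1) * laguerrePoly a k x := by
  have key : ∀ k ∈ Finset.range (n + 1), (-1 : ℝ) ^ k * n.choose k * Gamma (n + a + 1) *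
      k.factorial / Gamma (k + a + 1) * laguerrePoly a k x =
      ∑ j ∈ Finset.range (n + 1), (-1) ^ j * Gamma (n + a + 1) / Gamma (j + a + 1) * x ^ j *
        ((-1) ^ k * n.choose k * k.choose j * (1 - 0) ^ (k - j)) := by
    intro k hk
    have hk' : k ≤ n := Nat.lt_succ_iff.mp (Finset.mem_range.mp hk)
    rw [laguerrePoly_eq ha k hx]
    have hext : ∑ j ∈ Finset.range (k + 1), (-1 : ℝ) ^ j * (k.choose j) / Gamma (j + a + 1) * x ^ j
        = ∑ j ∈ Finset.range (n + 1), (-1) ^ j * (k.choose j) / Gamma (j + a + 1) * x ^ j := by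
      refine Finset.sum_subset (Finset.range_mono (by omega)) fun j _ hj => ?_
      rw [Nat.choose_eq_zero_of_lt (by simpa using hj)]
      simp
    rw [hext, Finset.mul_sum, Finset.mul_sum]
    refine Finset.sum_congr rfl fun j _ => ?_
    have h1 := (Gamma_add_one_pos ha k).ne'
    have h2 := (Gamma_add_one_pos ha j).ne'
    have h3 : (k.factorial : ℝ) ≠ 0 := by positivity
    simp only [sub_zero, one_pow, mul_one]
    field_simp
  rw [Finset.sum_congr rfl key, Finset.sum_comm]
  simp_rw [← Finset.mul_sum]
  rw [Finset.sum_eq_single n]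
  · rw [sum_choose_mul_choose n n 0 le_rfl]
    have h1 := (Gamma_add_one_pos ha n).ne'
    have h4 : (-1 : ℝ) ^ n * (-1) ^ n = 1 := by rw [← mul_pow]; simp
    simp only [Nat.choose_self, Nat.cast_one, mul_one, Nat.sub_self, pow_zero]
    rw [mul_div_assoc, div_self h1]
    linear_combination (-(x ^ n)) * h4
  · intro j hj hne
    have hj' : j ≤ n := Nat.lt_succ_iff.mp (Finset.mem_range.mp hj)
    rw [sum_choose_mul_choose n j 0 hj', zero_pow (by omega)]
    simp
  · intro h; simp at h

/-! ### Integrals against the Gamma law -/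

lemma gammaMeasure_eq {a : ℝ} :
    ProbabilityTheory.gammaMeasure (a + 1) 1 =
      (volume.restrict (Ioi 0)).withDensity
        (fun x => ENNReal.ofReal (x ^ a * Real.exp (-x) / Gamma (a + 1))) := by
  unfold ProbabilityTheory.gammaMeasure
  rw [← withDensity_indicator measurableSet_Ioi]
  refine withDensity_congr_ae ?_
  have h0 : ∀ᵐ x : ℝ, x ≠ 0 := by simp [ae_iff]
  filter_upwards [h0] with x hx
  rcases lt_or_gt_of_ne hx with h | h
  · rw [ProbabilityTheory.gammaPDF_of_neg h, indicator_of_notMem (by simpa using h.le)]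
  · rw [ProbabilityTheory.gammaPDF_of_nonneg h.le, indicator_of_mem (by simpa using h)]
    congr 1
    simp
    ring

lemma ae_pos_gammaMeasure (a : ℝ) :
    ∀ᵐ x ∂(ProbabilityTheory.gammaMeasure (a + 1) 1), 0 < x := by
  rw [gammaMeasure_eq]
  refine (withDensity_absolutelyContinuous _ _).ae_le ?_
  exact ae_restrict_mem measurableSet_Ioi

lemma integrable_gammaMeasure_iff {a : ℝ} (ha : -1 < a) {f : ℝ → ℝ} :
    Integrable f (ProbabilityTheory.gammaMeasure (a + 1) 1) ↔
      IntegrableOn (fun x => f x * (x ^ a * Real.exp (-x) / Gamma (a + 1))) (Ioi 0) := by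
  have hG := Gamma_add_one_pos ha 0
  simp only [CharP.cast_eq_zero, zero_add] at hG
  rw [gammaMeasure_eq, integrable_withDensity_iff (by fun_prop) (by simp), IntegrableOn]
  refine integrable_congr ?_
  filter_upwards [ae_restrict_mem measurableSet_Ioi] with x hx
  have hx : 0 < x := hx
  rw [ENNReal.toReal_ofReal (by positivity)]

lemma integral_gammaMeasure {a : ℝ} (ha : -1 < a) (f : ℝ → ℝ) :
    ∫ x, f x ∂(ProbabilityTheory.gammaMeasure (a + 1) 1) =
      ∫ x in Ioi 0, f x * (x ^ a * Real.exp (-x) / Gamma (a + 1)) := by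
  have hG := Gamma_add_one_pos ha 0
  simp only [CharP.cast_eq_zero, zero_add] at hG
  rw [gammaMeasure_eq, integral_withDensity_eq_integral_toReal_smul (by fun_prop) (by simp)]
  refine setIntegral_congr_fun measurableSet_Ioi fun x hx => ?_
  have hx : 0 < x := hx
  simp only [smul_eq_mul]
  rw [ENNReal.toReal_ofReal (by positivity), mul_comm]

lemma integrableOn_rpow_mul_exp {c b : ℝ} (hc : 0 < c) (hb : 0 < b) :
    IntegrableOn (fun x : ℝ => x ^ (c - 1) * Real.exp (-(b * x))) (Ioi 0) := by
  refine Integrable.of_integral_ne_zero ?_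
  rw [Real.integral_rpow_mul_exp_neg_mul_Ioi hc hb]
  have := Gamma_pos_of_pos hc
  positivity

lemma gamma_moment_aux {a b x : ℝ} (n : ℕ) (hx : 0 < x) :
    x ^ n * Real.exp (-(b * x)) * (x ^ a * Real.exp (-x) / Gamma (a + 1)) =
      (Gamma (a + 1))⁻¹ * (x ^ (((n : ℝ) + a + 1) - 1) * Real.exp (-((1 + b) * x))) := by
  have : ((n : ℝ) + a + 1) - 1 = n + a := by ring
  rw [this, Real.rpow_add hx, Real.rpow_natCast]
  have : Real.exp (-((1 + b) * x)) = Real.exp (-(b * x)) * Real.exp (-x) := by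
    rw [← Real.exp_add]; congr 1; ring
  rw [this]
  ring

lemma integrable_pow_mul_exp {a b : ℝ} (ha : -1 < a) (hb : 0 < 1 + b) (n : ℕ) :
    Integrable (fun x => x ^ n * Real.exp (-(b * x)))
      (ProbabilityTheory.gammaMeasure (a + 1) 1) := by
  rw [integrable_gammaMeasure_iff ha]
  refine IntegrableOn.congr_fun ((integrableOn_rpow_mul_exp (add_one_pos ha n) hb).const_mul
    (Gamma (a + 1))⁻¹) (fun x hx => ?_) measurableSet_Ioi
  exact (gamma_moment_aux n hx).symm

lemma integral_pow_mul_exp {a b : ℝ} (ha : -1 < a) (hb : 0 < 1 + b) (n : ℕ) :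
    ∫ x, x ^ n * Real.exp (-(b * x)) ∂(ProbabilityTheory.gammaMeasure (a + 1) 1) =
      Gamma (n + a + 1) / Gamma (a + 1) * (1 / (1 + b)) ^ ((n : ℝ) + a + 1) := by
  rw [integral_gammaMeasure ha, setIntegral_congr_fun measurableSet_Ioi
    (fun x hx => gamma_moment_aux (a := a) (b := b) n hx), integral_const_mul,
    Real.integral_rpow_mul_exp_neg_mul_Ioi (add_one_pos ha n) hb]
  ring

lemma integrable_pow_gamma {a : ℝ} (ha : -1 < a) (n : ℕ) :
    Integrable (fun x => x ^ n) (ProbabilityTheory.gammaMeasure (a + 1) 1) := by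
  simpa using integrable_pow_mul_exp (b := 0) ha (by norm_num) n

/-! ### The one-dimensional heat kernel -/

/-- The one-dimensional factor of the Laguerre heat kernel. -/
noncomputable def heatFactor (a t x y : ℝ) : ℝ :=
  Gamma (a + 1) / (1 - Real.exp (-t)) *
    Real.exp (-(Real.exp (-t) / (1 - Real.exp (-t))) * (x + y)) *
    √(Real.exp (-t) * x * y) ^ (-a) *
    besselI a (2 * √(Real.exp (-t) * x * y) / (1 - Real.exp (-t)))

/-- The summands of the expansion of `heatFactor` in powers of `y`, with `r = e^{-t}`. -/
noncomputable def heatTerm (a r x : ℝ) (m : ℕ) (y : ℝ) : ℝ :=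
  Gamma (a + 1) * (1 / (1 - r)) ^ (a + 1) * Real.exp (-(r / (1 - r) * x)) *
    (r * x / (1 - r) ^ 2) ^ m / (m.factorial * Gamma (m + a + 1)) *
    (y ^ m * Real.exp (-(r / (1 - r) * y)))

lemma heatFactor_eq_tsum {a t x y : ℝ} (ht : 0 < t) (hx : 0 < x) (hy : 0 < y) :
    heatFactor a t x y = ∑' m, heatTerm a (Real.exp (-t)) x m y := by
  unfold heatFactor besselI
  rw [← tsum_mul_left]
  refine tsum_congr fun m => ?_
  unfold heatTerm
  set r := Real.exp (-t) with hr
  have hr0 : 0 < r := Real.exp_pos _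
  have hr1 : 0 < 1 - r := by
    have : r < 1 := by rw [hr, Real.exp_lt_one_iff]; linarith
    linarith
  have hp : 0 < r * x * y := by positivity
  have hs : 0 < √(r * x * y) := Real.sqrt_pos.mpr hp
  have e1 : 2 * √(r * x * y) / (1 - r) / 2 = √(r * x * y) / (1 - r) := by ring
  have e2 : (2 * √(r * x * y) / (1 - r) / 2) ^ (2 * (m : ℝ) + a) =
      (r * x * y) ^ m / ((1 - r) ^ 2) ^ m * (√(r * x * y) ^ a / (1 - r) ^ a) := by
    rw [e1, Real.rpow_add (by positivity), Real.div_rpow hs.le hr1.le, Real.div_rpow hs.le hr1.le,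
      Real.rpow_mul hs.le, Real.rpow_mul hr1.le, Real.rpow_natCast, Real.rpow_natCast]
    have : √(r * x * y) ^ (2 : ℝ) = r * x * y := by
      rw [show (2 : ℝ) = ((2 : ℕ) : ℝ) by norm_num, Real.rpow_natCast, Real.sq_sqrt hp.le]
    rw [this, show (2 : ℝ) = ((2 : ℕ) : ℝ) by norm_num, Real.rpow_natCast]
  rw [e2, Real.rpow_neg hs.le, one_div, Real.inv_rpow hr1.le, Real.rpow_add hr1, Real.rpow_one]
  have h3 : Real.exp (-(r / (1 - r)) * (x + y)) =
      Real.exp (-(r / (1 - r) * x)) * Real.exp (-(r / (1 - r) * y)) := by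
    rw [← Real.exp_add]; congr 1; ring
  have h4 := Real.rpow_pos_of_pos hs a
  have h5 := Real.rpow_pos_of_pos hr1 a
  rw [h3, mul_pow, div_pow]
  field_simp

lemma heatTerm_nonneg {a r x y : ℝ} (ha : -1 < a) (hr0 : 0 < r) (hr1 : r < 1) (hx : 0 < x)
    (hy : 0 < y) (m : ℕ) : 0 ≤ heatTerm a r x m y := by
  have hr2 : 0 < 1 - r := by linarith
  have h1 := Gamma_add_one_pos ha m
  have h0 := Gamma_add_one_pos ha 0
  simp only [CharP.cast_eq_zero, zero_add] at h0
  unfold heatTerm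
  positivity

lemma heatFactor_nonneg {a t x y : ℝ} (ha : -1 < a) (ht : 0 < t) (hx : 0 < x) (hy : 0 < y) :
    0 ≤ heatFactor a t x y := by
  rw [heatFactor_eq_tsum ht hx hy]
  exact tsum_nonneg fun m => heatTerm_nonneg ha (Real.exp_pos _)
    (by rw [Real.exp_lt_one_iff]; linarith) hx hy m

lemma heatFactor_comm (a t x y : ℝ) : heatFactor a t x y = heatFactor a t y x := by
  unfold heatFactor
  rw [add_comm x y, mul_right_comm _ x y]

/-- The factorial-type moments of the Poisson law, in unnormalised form. -/
lemma hasSum_poisson_gamma {a : ℝ} (ha : -1 < a) (ρ : ℝ) (n : ℕ) :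
    HasSum (fun m : ℕ => ρ ^ m / m.factorial * (Gamma (((m + n : ℕ) : ℝ) + a + 1) /
        Gamma (m + a + 1)))
      (Real.exp ρ * ∑ j ∈ Finset.range (n + 1),
        n.choose j * (Gamma (n + a + 1) / Gamma (j + a + 1)) * ρ ^ j) := by
  induction n generalizing a with
  | zero =>
    have h := NormedSpace.expSeries_div_hasSum_exp ρ
    rw [← Real.exp_eq_exp_ℝ] at h
    have h0 := (Gamma_add_one_pos ha 0).ne'
    simp only [add_zero, zero_add, Finset.range_one, Finset.sum_singleton, Nat.choose_self,
      Nat.cast_one, pow_zero, mul_one, div_self h0]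
    refine h.congr_fun fun m => ?_
    simp [div_self (Gamma_add_one_pos ha m).ne']
  | succ n ih =>
    have h1 := (ih ha).mul_left ((n : ℝ) + a + 1)
    have h2 := (ih (a := a + 1) (by linarith)).mul_left ρ
    -- the part of the summand carrying the factor `m` is a shifted series with `a + 1` for `a`
    have h3 : HasSum (fun m : ℕ => (m : ℝ) * (ρ ^ m / m.factorial *
        (Gamma (((m + n : ℕ) : ℝ) + a + 1) / Gamma (m + a + 1))))
        (ρ * (Real.exp ρ * ∑ j ∈ Finset.range (n + 1), n.choose j *
          (Gamma (n + (a + 1) + 1) / Gamma (j + (a + 1) + 1)) * ρ ^ j)) := by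
      rw [← hasSum_nat_add_iff' 1]
      simp only [Finset.range_one, Finset.sum_singleton, CharP.cast_eq_zero, zero_mul, sub_zero]
      refine h2.congr_fun fun m => ?_
      have e1 : ((m + 1 + n : ℕ) : ℝ) + a + 1 = ((m + n : ℕ) : ℝ) + (a + 1) + 1 := by
        push_cast; ring
      have e2 : ((m + 1 : ℕ) : ℝ) + a + 1 = (m : ℝ) + (a + 1) + 1 := by push_cast; ring
      rw [e1, e2, Nat.factorial_succ]
      have : (m.factorial : ℝ) ≠ 0 := by positivity
      push_cast
      rw [pow_succ]
      field_simp
    have h4 := h1.add h3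
    have hfun : ∀ m : ℕ, ρ ^ m / m.factorial *
        (Gamma (((m + (n + 1) : ℕ) : ℝ) + a + 1) / Gamma (m + a + 1)) =
        ((n : ℝ) + a + 1) * (ρ ^ m / m.factorial *
          (Gamma (((m + n : ℕ) : ℝ) + a + 1) / Gamma (m + a + 1))) +
        m * (ρ ^ m / m.factorial *
          (Gamma (((m + n : ℕ) : ℝ) + a + 1) / Gamma (m + a + 1))) := by
      intro m
      rw [show m + (n + 1) = m + n + 1 by ring, Gamma_succ_add ha (m + n)]
      push_cast
      ring
    convert! h4.congr_fun hfun using 1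
    rw [← mul_assoc, ← mul_assoc, mul_comm _ (Real.exp ρ), mul_comm ρ (Real.exp ρ), mul_assoc,
      mul_assoc, ← mul_add]
    congr 1
    rw [Finset.sum_range_succ' _ (n + 1), Finset.mul_sum, Finset.mul_sum]
    have hext : ∑ j ∈ Finset.range (n + 1), ((n : ℝ) + a + 1) *
        (n.choose j * (Gamma (n + a + 1) / Gamma (j + a + 1)) * ρ ^ j) =
        ∑ j ∈ Finset.range (n + 2), ((n : ℝ) + a + 1) *
        (n.choose j * (Gamma (n + a + 1) / Gamma (j + a + 1)) * ρ ^ j) := by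
      rw [Finset.sum_range_succ _ (n + 1), Nat.choose_succ_self]
      simp
    rw [hext, Finset.sum_range_succ' _ (n + 1), add_right_comm (Finset.sum _ _),
      ← Finset.sum_add_distrib]
    congr 1
    · refine Finset.sum_congr rfl fun j _ => ?_
      rw [Gamma_succ_add ha n, Nat.choose_succ_succ]
      have e1 : (n : ℝ) + (a + 1) + 1 = ((n + 1 : ℕ) : ℝ) + a + 1 := by push_cast; ring
      have e2 : (j : ℝ) + (a + 1) + 1 = ((j + 1 : ℕ) : ℝ) + a + 1 := by push_cast; ring
      rw [e1, e2, Gamma_succ_add ha n]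
      push_cast
      ring
    · rw [Gamma_succ_add ha n]
      simp
      ring

lemma integral_heatTerm_mul_pow {a r : ℝ} (ha : -1 < a) (hr1 : r < 1) (x : ℝ)
    (m n : ℕ) :
    ∫ y, heatTerm a r x m y * y ^ n ∂(ProbabilityTheory.gammaMeasure (a + 1) 1) =
      (1 - r) ^ n * Real.exp (-(r * x / (1 - r))) * ((r * x / (1 - r)) ^ m / m.factorial *
        (Gamma (((m + n : ℕ) : ℝ) + a + 1) / Gamma (m + a + 1))) := by
  have hr2 : 0 < 1 - r := by linarith
  have hb : 1 + r / (1 - r) = 1 / (1 - r) := by field_simp; ring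
  have hb' : 0 < 1 + r / (1 - r) := by rw [hb]; positivity
  have h0 := (Gamma_add_one_pos ha 0).ne'
  simp only [CharP.cast_eq_zero, zero_add] at h0
  have h1 : ∀ y, heatTerm a r x m y * y ^ n = Gamma (a + 1) * (1 / (1 - r)) ^ (a + 1) *
      Real.exp (-(r / (1 - r) * x)) *
      (r * x / (1 - r) ^ 2) ^ m / (m.factorial * Gamma (m + a + 1)) *
      (y ^ (m + n) * Real.exp (-(r / (1 - r) * y))) := by
    intro y; unfold heatTerm; rw [pow_add]; ring
  simp_rw [h1]
  rw [integral_const_mul, integral_pow_mul_exp ha hb', hb, one_div_one_div,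
    add_assoc (((m + n : ℕ) : ℝ)) a 1,
    Real.rpow_add hr2 _ (a + 1), Real.rpow_natCast, one_div, Real.inv_rpow hr2.le, pow_add,
    show r / (1 - r) * x = r * x / (1 - r) by ring, div_pow, div_pow]
  have h2 := Real.rpow_pos_of_pos hr2 (a + 1)
  have h3 := (Gamma_add_one_pos ha m).ne'
  rw [add_assoc] at h3
  have h4 : (m.factorial : ℝ) ≠ 0 := by positivity
  simp only [add_assoc]
  rw [← pow_mul, mul_comm 2 m, pow_mul]
  field_simp

lemma integrable_heatTerm_mul_pow {a r : ℝ} (ha : -1 < a) (hr1 : r < 1) (x : ℝ) (m n : ℕ) :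
    Integrable (fun y => heatTerm a r x m y * y ^ n)
      (ProbabilityTheory.gammaMeasure (a + 1) 1) := by
  have hr2 : 0 < 1 - r := by linarith
  have hb : 1 + r / (1 - r) = 1 / (1 - r) := by field_simp; ring
  have hb' : 0 < 1 + r / (1 - r) := by rw [hb]; positivity
  refine ((integrable_pow_mul_exp ha hb' (m + n)).const_mul (Gamma (a + 1) *
    (1 / (1 - r)) ^ (a + 1) * Real.exp (-(r / (1 - r) * x)) *
      (r * x / (1 - r) ^ 2) ^ m / (m.factorial * Gamma (m + a + 1)))).congr
    (ae_of_all _ fun y => ?_)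
  unfold heatTerm
  simp only [pow_add]
  ring

/-- The heat kernel acting on a monomial, with integrability. -/
lemma heatFactor_mul_pow {a t x : ℝ} (ha : -1 < a) (ht : 0 < t) (hx : 0 < x) (n : ℕ) :
    Integrable (fun y => heatFactor a t x y * y ^ n) (ProbabilityTheory.gammaMeasure (a + 1) 1) ∧
    ∫ y, heatFactor a t x y * y ^ n ∂(ProbabilityTheory.gammaMeasure (a + 1) 1) =
      ∑ j ∈ Finset.range (n + 1), n.choose j * (Gamma (n + a + 1) / Gamma (j + a + 1)) *
        (1 - Real.exp (-t)) ^ (n - j) * (Real.exp (-t) * x) ^ j := by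
  set r := Real.exp (-t) with hr
  have hr0 : 0 < r := Real.exp_pos _
  have hr1 : r < 1 := by rw [hr, Real.exp_lt_one_iff]; linarith
  have hr2 : 0 < 1 - r := by linarith
  have hsum := (hasSum_poisson_gamma ha (r * x / (1 - r)) n).mul_left
    ((1 - r) ^ n * Real.exp (-(r * x / (1 - r))))
  have hsum' : Summable fun m => ∫ y, ‖heatTerm a r x m y * y ^ n‖
      ∂(ProbabilityTheory.gammaMeasure (a + 1) 1) := by
    refine hsum.summable.congr fun m => ?_
    rw [← integral_heatTerm_mul_pow ha hr1 x m n]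
    refine integral_congr_ae ?_
    filter_upwards [ae_pos_gammaMeasure a] with y hy
    have := heatTerm_nonneg ha hr0 hr1 hx hy m
    rw [Real.norm_of_nonneg (by positivity)]
  have hint := fun m => integrable_heatTerm_mul_pow ha hr1 x m n
  have key := hasSum_integral_of_summable_integral_norm hint hsum'
  have heq : (fun y => heatFactor a t x y * y ^ n) =ᵐ[ProbabilityTheory.gammaMeasure (a + 1) 1]
      fun y => ∑' m, heatTerm a r x m y * y ^ n := by
    filter_upwards [ae_pos_gammaMeasure a] with y hy
    rw [heatFactor_eq_tsum ht hx hy, tsum_mul_right]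
  have hval : ∫ y, heatFactor a t x y * y ^ n ∂(ProbabilityTheory.gammaMeasure (a + 1) 1) =
      ∑ j ∈ Finset.range (n + 1), n.choose j * (Gamma (n + a + 1) / Gamma (j + a + 1)) *
        (1 - r) ^ (n - j) * (r * x) ^ j := by
    rw [integral_congr_ae heq, ← key.tsum_eq]
    simp_rw [integral_heatTerm_mul_pow ha hr1 x _ n]
    rw [hsum.tsum_eq, ← mul_assoc, mul_assoc ((1 - r) ^ n), ← Real.exp_add, neg_add_cancel,
      Real.exp_zero, mul_one, Finset.mul_sum]
    refine Finset.sum_congr rfl fun j hj => ?_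
    have hj' : j ≤ n := Nat.lt_succ_iff.mp (Finset.mem_range.mp hj)
    have : (1 - r) ^ n = (1 - r) ^ (n - j) * (1 - r) ^ j := by
      rw [← pow_add, Nat.sub_add_cancel hj']
    rw [this, div_pow]
    field_simp
  -- the value is positive, so the Bochner integral is not the default value `0`
  refine ⟨Integrable.of_integral_ne_zero ?_, hval⟩
  rw [hval]
  refine (Finset.sum_pos (fun j hj => ?_) (by simp)).ne'
  have hj' : j ≤ n := Nat.lt_succ_iff.mp (Finset.mem_range.mp hj)
  have h1 := Gamma_add_one_pos ha n
  have h2 := Gamma_add_one_pos ha j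
  have h3 : (0 : ℝ) < n.choose j := by exact_mod_cast Nat.choose_pos hj'
  positivity

/-- One-dimensional eigenfunction relation `T_t L_k = e^{-kt} L_k`. -/
lemma heatFactor_mul_laguerrePoly {a t x : ℝ} (ha : -1 < a) (ht : 0 < t) (hx : 0 < x) (k : ℕ) :
    Integrable (fun y => heatFactor a t x y * laguerrePoly a k y)
      (ProbabilityTheory.gammaMeasure (a + 1) 1) ∧
    ∫ y, heatFactor a t x y * laguerrePoly a k y ∂(ProbabilityTheory.gammaMeasure (a + 1) 1) =
      Real.exp (-t) ^ k * laguerrePoly a k x := by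
  have heq : (fun y => heatFactor a t x y * laguerrePoly a k y)
      =ᵐ[ProbabilityTheory.gammaMeasure (a + 1) 1]
      fun y => ∑ n ∈ Finset.range (k + 1), Gamma (k + a + 1) / k.factorial *
        ((-1) ^ n * (k.choose n) / Gamma (n + a + 1)) * (heatFactor a t x y * y ^ n) := by
    filter_upwards [ae_pos_gammaMeasure a] with y hy
    rw [laguerrePoly_eq ha k hy, Finset.mul_sum, Finset.mul_sum]
    refine Finset.sum_congr rfl fun n _ => ?_
    ring
  have hint := fun n : ℕ => ((heatFactor_mul_pow ha ht hx n).1.const_mul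
    (Gamma (k + a + 1) / k.factorial * ((-1) ^ n * (k.choose n) / Gamma (n + a + 1))))
  refine ⟨(integrable_finsetSum _ fun n _ => hint n).congr heq.symm, ?_⟩
  rw [integral_congr_ae heq, integral_finsetSum _ fun n _ => hint n]
  simp_rw [integral_const_mul, (heatFactor_mul_pow ha ht hx _).2]
  set r := Real.exp (-t) with hr
  have key : ∀ n ∈ Finset.range (k + 1), Gamma (k + a + 1) / k.factorial *
      ((-1) ^ n * (k.choose n) / Gamma (n + a + 1)) *
      ∑ j ∈ Finset.range (n + 1), n.choose j * (Gamma (n + a + 1) / Gamma (j + a + 1)) *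
        (1 - r) ^ (n - j) * (r * x) ^ j =
      ∑ j ∈ Finset.range (k + 1), Gamma (k + a + 1) / k.factorial * (r * x) ^ j /
        Gamma (j + a + 1) * ((-1) ^ n * k.choose n * n.choose j * (1 - r) ^ (n - j)) := by
    intro n hn
    have hn' : n ≤ k := Nat.lt_succ_iff.mp (Finset.mem_range.mp hn)
    have hext : ∑ j ∈ Finset.range (n + 1), n.choose j *
        (Gamma (n + a + 1) / Gamma (j + a + 1)) * (1 - r) ^ (n - j) * (r * x) ^ j =
        ∑ j ∈ Finset.range (k + 1), n.choose j *
        (Gamma (n + a + 1) / Gamma (j + a + 1)) * (1 - r) ^ (n - j) * (r * x) ^ j := by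
      refine Finset.sum_subset (Finset.range_mono (by omega)) fun j _ hj => ?_
      rw [Nat.choose_eq_zero_of_lt (by simpa using hj)]
      simp
    rw [hext, Finset.mul_sum]
    refine Finset.sum_congr rfl fun j _ => ?_
    have h1 := (Gamma_add_one_pos ha n).ne'
    have h2 := (Gamma_add_one_pos ha j).ne'
    field_simp
  rw [Finset.sum_congr rfl key, Finset.sum_comm, laguerrePoly_eq ha k hx, Finset.mul_sum,
    Finset.mul_sum]
  refine Finset.sum_congr rfl fun j hj => ?_
  have hj' : j ≤ k := Nat.lt_succ_iff.mp (Finset.mem_range.mp hj)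
  rw [← Finset.mul_sum, sum_choose_mul_choose k j r hj']
  have : r ^ k = r ^ (k - j) * r ^ j := by rw [← pow_add, Nat.sub_add_cancel hj']
  rw [this, mul_pow]
  ring

/-! ### The Laguerre measure -/

lemma isProbabilityMeasure_gamma {a : ℝ} (ha : -1 < a) :
    IsProbabilityMeasure (ProbabilityTheory.gammaMeasure (a + 1) 1) :=
  ProbabilityTheory.isProbabilityMeasure_gammaMeasure (by linarith) one_pos

section
variable {d : ℕ} {α : Fin d → ℝ}

lemma isProbabilityMeasure_laguerreMeasure (hα : ∀ i, -1 < α i) :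
    IsProbabilityMeasure (laguerreMeasure α) := by
  have := fun i => isProbabilityMeasure_gamma (hα i)
  unfold laguerreMeasure
  infer_instance

lemma ae_pos (hα : ∀ i, -1 < α i) : ∀ᵐ x ∂(laguerreMeasure α), ∀ i, 0 < x i := by
  have := fun i => isProbabilityMeasure_gamma (hα i)
  rw [ae_all_iff]
  intro i
  exact (Measure.tendsto_eval_ae_ae (μ := fun i => ProbabilityTheory.gammaMeasure (α i + 1) 1)
    (i := i)).eventually (ae_pos_gammaMeasure (α i))

lemma integrable_prod (hα : ∀ i, -1 < α i) {f : Fin d → ℝ → ℝ}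
    (hf : ∀ i, Integrable (f i) (ProbabilityTheory.gammaMeasure (α i + 1) 1)) :
    Integrable (fun x : Fin d → ℝ => ∏ i, f i (x i)) (laguerreMeasure α) := by
  have := fun i => isProbabilityMeasure_gamma (hα i)
  exact Integrable.fintype_prod hf

lemma integral_prod (hα : ∀ i, -1 < α i) (f : Fin d → ℝ → ℝ) :
    ∫ x, ∏ i, f i (x i) ∂(laguerreMeasure α) =
      ∏ i, ∫ y, f i y ∂(ProbabilityTheory.gammaMeasure (α i + 1) 1) := by
  have := fun i => isProbabilityMeasure_gamma (hα i)
  exact integral_fintype_prod_eq_prod f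

lemma integrable_monomial (hα : ∀ i, -1 < α i) (n : Fin d → ℕ) :
    Integrable (fun x : Fin d → ℝ => ∏ i, x i ^ n i) (laguerreMeasure α) :=
  integrable_prod hα fun i => integrable_pow_gamma (hα i) (n i)

lemma memLp_monomial (hα : ∀ i, -1 < α i) (n : Fin d → ℕ) :
    MemLp (fun x : Fin d → ℝ => ∏ i, x i ^ n i) 2 (laguerreMeasure α) := by
  rw [memLp_two_iff_integrable_sq (Measurable.aestronglyMeasurable (by fun_prop))]
  refine (integrable_monomial hα fun i => 2 * n i).congr (ae_of_all _ fun x => ?_)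
  simp only [← Finset.prod_pow]
  refine Finset.prod_congr rfl fun i _ => ?_
  rw [← pow_mul, mul_comm]

lemma laguerrePolyProd_eq_sum (hα : ∀ i, -1 < α i) (k : Fin d → ℕ) :
    ∃ c : (Fin d → ℕ) → ℝ, ∀ x : Fin d → ℝ, (∀ i, 0 < x i) →
      laguerrePolyProd α k x =
        ∑ n ∈ Fintype.piFinset (fun i => Finset.range (k i + 1)), c n * ∏ i, x i ^ n i := by
  refine ⟨fun n => ∏ i, (Gamma (k i + α i + 1) / (k i).factorial *
    ((-1) ^ n i * ((k i).choose (n i)) / Gamma (n i + α i + 1))), fun x hx => ?_⟩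
  unfold laguerrePolyProd
  simp_rw [← Finset.prod_mul_distrib]
  rw [← Finset.prod_univ_sum (fun i => Finset.range (k i + 1)) (fun i n =>
    Gamma (k i + α i + 1) / (k i).factorial *
    ((-1) ^ n * ((k i).choose n) / Gamma (n + α i + 1)) * x i ^ n)]
  refine Finset.prod_congr rfl fun i _ => ?_
  rw [laguerrePoly_eq (hα i) (k i) (hx i), Finset.mul_sum]
  refine Finset.sum_congr rfl fun n _ => ?_
  ring

lemma monomial_eq_sum (hα : ∀ i, -1 < α i) (n : Fin d → ℕ) :
    ∃ c : (Fin d → ℕ) → ℝ, ∀ x : Fin d → ℝ, (∀ i, 0 < x i) →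
      ∏ i, x i ^ n i =
        ∑ k ∈ Fintype.piFinset (fun i => Finset.range (n i + 1)), c k * laguerrePolyProd α k x := by
  refine ⟨fun k => ∏ i, ((-1) ^ k i * (n i).choose (k i) * Gamma (n i + α i + 1) *
      (k i).factorial / Gamma (k i + α i + 1)), fun x hx => ?_⟩
  unfold laguerrePolyProd
  simp_rw [← Finset.prod_mul_distrib]
  rw [← Finset.prod_univ_sum (fun i => Finset.range (n i + 1)) (fun i k =>
    (-1) ^ k * (n i).choose k * Gamma (n i + α i + 1) *
      k.factorial / Gamma (k + α i + 1) * laguerrePoly (α i) k (x i))]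
  exact Finset.prod_congr rfl fun i _ => pow_eq_sum_laguerrePoly (hα i) (n i) (hx i)

lemma memLp_laguerrePolyProd (hα : ∀ i, -1 < α i) (k : Fin d → ℕ) :
    MemLp (laguerrePolyProd α k) 2 (laguerreMeasure α) := by
  obtain ⟨c, hc⟩ := laguerrePolyProd_eq_sum hα k
  have h : MemLp (fun x : Fin d → ℝ => ∑ n ∈ Fintype.piFinset
      (fun i => Finset.range (k i + 1)), c n * ∏ i, x i ^ n i) 2 (laguerreMeasure α) :=
    memLp_finsetSum _ fun n _ => (memLp_monomial hα n).const_mul (c n)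
  refine h.ae_eq ?_
  filter_upwards [ae_pos hα] with x hx using (hc x hx).symm

lemma integrable_mul_laguerre (hα : ∀ i, -1 < α i) {h : (Fin d → ℝ) → ℝ}
    (hh : MemLp h 2 (laguerreMeasure α)) (k : Fin d → ℕ) :
    Integrable (fun x => h x * laguerrePolyProd α k x) (laguerreMeasure α) :=
  hh.integrable_mul (memLp_laguerrePolyProd hα k)

/-! ### Completeness of the Laguerre polynomials -/

lemma integrable_exp_linear (hα : ∀ i, -1 < α i) (c : Fin d → ℝ) {s : ℝ}
    (hs : |s| * ∑ i, |c i| < 1) :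
    Integrable (fun x : Fin d → ℝ => Real.exp (s * ∑ i, c i * x i)) (laguerreMeasure α) := by
  have h : Integrable (fun x : Fin d → ℝ => ∏ i, Real.exp (s * c i * x i)) (laguerreMeasure α) := by
    refine integrable_prod (f := fun i y => Real.exp (s * c i * y)) hα fun i => ?_
    have hb : 0 < 1 + -(s * c i) := by
      have h1 : |c i| ≤ ∑ i, |c i| :=
        Finset.single_le_sum (f := fun i => |c i|) (fun _ _ => abs_nonneg _) (Finset.mem_univ i)
      have h2 : s * c i ≤ |s| * ∑ i, |c i| := calc
        s * c i ≤ |s * c i| := le_abs_self _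
        _ = |s| * |c i| := abs_mul _ _
        _ ≤ _ := mul_le_mul_of_nonneg_left h1 (abs_nonneg _)
      linarith
    simpa using integrable_pow_mul_exp (hα i) hb 0
  refine h.congr (ae_of_all _ fun x => ?_)
  simp only [← Real.exp_sum]
  rw [Finset.mul_sum]
  simp only [mul_assoc]

lemma integral_mul_linear_pow_eq_zero (hα : ∀ i, -1 < α i) {h : (Fin d → ℝ) → ℝ}
    (hh : MemLp h 2 (laguerreMeasure α))
    (hk : ∀ k, ∫ x, h x * laguerrePolyProd α k x ∂(laguerreMeasure α) = 0)
    (c : Fin d → ℝ) (N : ℕ) :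
    ∫ x, h x * (∑ i, c i * x i) ^ N ∂(laguerreMeasure α) = 0 := by
  have hmono : ∀ n : Fin d → ℕ, ∫ x, h x * ∏ i, x i ^ n i ∂(laguerreMeasure α) = 0 := by
    intro n
    obtain ⟨b, hb⟩ := monomial_eq_sum hα n
    have : (fun x : Fin d → ℝ => h x * ∏ i, x i ^ n i) =ᵐ[laguerreMeasure α] fun x =>
        ∑ k ∈ Fintype.piFinset (fun i => Finset.range (n i + 1)),
          b k * (h x * laguerrePolyProd α k x) := by
      filter_upwards [ae_pos hα] with x hx
      rw [hb x hx, Finset.mul_sum]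
      exact Finset.sum_congr rfl fun k _ => by ring
    rw [integral_congr_ae this, integral_finsetSum]
    · simp [integral_const_mul, hk]
    · intro k _
      exact (hh.integrable_mul (memLp_laguerrePolyProd hα k)).const_mul _
  simp_rw [Finset.sum_pow_eq_sum_piAntidiag, Finset.mul_sum, mul_pow, Finset.prod_mul_distrib]
  rw [integral_finsetSum]
  · refine Finset.sum_eq_zero fun n _ => ?_
    have : ∀ x : Fin d → ℝ, h x * ((Nat.multinomial Finset.univ n : ℝ) *
        ((∏ i, c i ^ n i) * ∏ i, x i ^ n i)) =
        (Nat.multinomial Finset.univ n : ℝ) * (∏ i, c i ^ n i) * (h x * ∏ i, x i ^ n i) := by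
      intro x; ring
    simp_rw [this]
    rw [integral_const_mul, hmono, mul_zero]
  · intro n _
    have := (hh.integrable_mul (memLp_monomial hα n)).const_mul
      ((Nat.multinomial Finset.univ n : ℝ) * (∏ i, c i ^ n i))
    refine this.congr (ae_of_all _ fun x => ?_)
    simp only [Pi.mul_apply]
    ring

lemma integrable_withDensity_ofReal {Ω : Type*} [MeasurableSpace Ω] {μ : Measure Ω}
    {h g : Ω → ℝ} (hm : Measurable h) (hg : AEStronglyMeasurable g μ)
    (hint : Integrable (fun x => h x * g x) μ) :
    Integrable g (μ.withDensity fun x => ENNReal.ofReal (h x)) := by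
  rw [integrable_withDensity_iff (by fun_prop) (by simp)]
  refine hint.mono (hg.mul hm.ennreal_ofReal.ennreal_toReal.aestronglyMeasurable)
    (ae_of_all _ fun x => ?_)
  rw [norm_mul, norm_mul, mul_comm]
  refine mul_le_mul_of_nonneg_right ?_ (norm_nonneg _)
  rw [ENNReal.toReal_ofReal', Real.norm_eq_abs, Real.norm_eq_abs, abs_of_nonneg (le_max_right _ _)]
  exact max_le (le_abs_self _) (abs_nonneg _)

/-- Integration against the signed measure `h μ`, through its positive and negative parts. -/
lemma integral_withDensity_sub {Ω : Type*} [MeasurableSpace Ω] {μ : Measure Ω}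
    {h g : Ω → ℝ} (hm : Measurable h) (hg : AEStronglyMeasurable g μ)
    (hint : Integrable (fun x => h x * g x) μ) :
    ∫ x, g x ∂(μ.withDensity fun x => ENNReal.ofReal (h x)) -
      ∫ x, g x ∂(μ.withDensity fun x => ENNReal.ofReal (-h x)) = ∫ x, h x * g x ∂μ := by
  have h1 := integrable_withDensity_ofReal hm hg hint
  have h2 := integrable_withDensity_ofReal (h := fun x => -h x) (by fun_prop) hg
    (by simpa using hint.neg)
  rw [integrable_withDensity_iff (by fun_prop) (by simp)] at h1 h2
  rw [integral_withDensity_eq_integral_toReal_smul (by fun_prop) (by simp),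
    integral_withDensity_eq_integral_toReal_smul (by fun_prop) (by simp), ← integral_sub]
  · refine integral_congr_ae (ae_of_all _ fun x => ?_)
    simp only [smul_eq_mul, ENNReal.toReal_ofReal', ← sub_mul]
    congr 1
    rcases le_total 0 (h x) with hx | hx
    · rw [max_eq_left hx, max_eq_right (by linarith), sub_zero]
    · rw [max_eq_right hx, max_eq_left (by linarith)]; ring
  · simpa [mul_comm] using h1
  · simpa [mul_comm] using h2

/-- Completeness of the Laguerre polynomials, for measurable functions: all moments of the
measures `h⁺ μ` and `h⁻ μ` agree, hence so do their (analytic) complex moment generating functions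
along every linear functional, hence their characteristic functions. -/
lemma ae_eq_zero_of_measurable (hα : ∀ i, -1 < α i) {h : (Fin d → ℝ) → ℝ}
    (hm : Measurable h) (hh : MemLp h 2 (laguerreMeasure α))
    (hk : ∀ k, ∫ x, h x * laguerrePolyProd α k x ∂(laguerreMeasure α) = 0) :
    h =ᵐ[laguerreMeasure α] 0 := by
  have hprob := isProbabilityMeasure_laguerreMeasure hα
  set μ := laguerreMeasure α with hμ
  set ν₁ := μ.withDensity fun x => ENNReal.ofReal (h x) with hν₁
  set ν₂ := μ.withDensity fun x => ENNReal.ofReal (-h x) with hν₂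
  have hint : Integrable h μ := hh.integrable (by norm_num)
  have hfin₁ : IsFiniteMeasure ν₁ := isFiniteMeasure_withDensity_ofReal hint.2
  have hfin₂ : IsFiniteMeasure ν₂ := isFiniteMeasure_withDensity_ofReal hint.neg.2
  have key : ν₁ = ν₂ := by
    refine Measure.ext_of_charFunDual ?_
    funext L
    set c : Fin d → ℝ := fun i => L (Pi.single i 1) with hc
    have hL : ∀ x, L x = ∑ i, c i * x i := by
      intro x
      conv_lhs => rw [pi_eq_sum_univ' x, map_sum]
      refine Finset.sum_congr rfl fun i _ => ?_
      rw [map_smul, smul_eq_mul, mul_comm]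
    set X : (Fin d → ℝ) → ℝ := fun x => L x with hX
    have hXm : Measurable X := L.continuous.measurable
    -- `ε` is chosen so that `e^{2s⟨c,x⟩}` is `μ`-integrable, that is, `e^{s⟨c,x⟩} ∈ L²`, for `|s| < ε`
    set ε : ℝ := 1 / (2 * (∑ i, |c i|) + 1) with hε
    have hS : 0 ≤ ∑ i, |c i| := Finset.sum_nonneg fun _ _ => abs_nonneg _
    have hε0 : 0 < ε := by positivity
    have hexp : ∀ s : ℝ, |s| < ε → Integrable (fun x => h x * Real.exp (s * X x)) μ := by
      intro s hs
      refine hh.integrable_mul (q := 2) ?_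
      rw [memLp_two_iff_integrable_sq (Measurable.aestronglyMeasurable (by fun_prop))]
      refine (integrable_exp_linear hα c (s := 2 * s) ?_).congr (ae_of_all _ fun x => ?_)
      · rw [abs_mul, abs_two]
        rw [hε, lt_div_iff₀ (by positivity)] at hs
        rcases eq_or_lt_of_le hS with h0 | h0
        · rw [← h0]; simp
        · nlinarith [abs_nonneg s]
      · simp only [hX, hL, ← Real.exp_nat_mul]
        congr 1
        push_cast
        ring
    have hsub₁ : Ioo (-ε) ε ⊆ ProbabilityTheory.integrableExpSet X ν₁ := fun s hs =>
      integrable_withDensity_ofReal hm (Measurable.aestronglyMeasurable (by fun_prop))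
        (hexp s (abs_lt.mpr hs))
    have hsub₂ : Ioo (-ε) ε ⊆ ProbabilityTheory.integrableExpSet X ν₂ := fun s hs =>
      integrable_withDensity_ofReal (h := fun x => -h x) (by fun_prop)
        (Measurable.aestronglyMeasurable (by fun_prop))
        (by simpa using (hexp s (abs_lt.mpr hs)).neg)
    have hre : ∀ z : ℂ, z ∈ {z : ℂ | z.re ∈ Ioo (-ε) ε} →
        z.re ∈ interior (ProbabilityTheory.integrableExpSet X ν₁) ∧
        z.re ∈ interior (ProbabilityTheory.integrableExpSet X ν₂) := fun z hz =>
      ⟨interior_maximal hsub₁ isOpen_Ioo hz, interior_maximal hsub₂ isOpen_Ioo hz⟩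
    have h0mem : (0 : ℂ) ∈ {z : ℂ | z.re ∈ Ioo (-ε) ε} := by simp [hε0]
    have hImem : Complex.I ∈ {z : ℂ | z.re ∈ Ioo (-ε) ε} := by simp [hε0]
    have hA₁ : AnalyticOnNhd ℂ (ProbabilityTheory.complexMGF X ν₁)
        {z : ℂ | z.re ∈ Ioo (-ε) ε} := fun z hz =>
      ProbabilityTheory.analyticAt_complexMGF (hre z hz).1
    have hA₂ : AnalyticOnNhd ℂ (ProbabilityTheory.complexMGF X ν₂)
        {z : ℂ | z.re ∈ Ioo (-ε) ε} := fun z hz =>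
      ProbabilityTheory.analyticAt_complexMGF (hre z hz).2
    have hder : ∀ n, iteratedDeriv n (ProbabilityTheory.complexMGF X ν₁ -
        ProbabilityTheory.complexMGF X ν₂) 0 = 0 := by
      intro n
      rw [iteratedDeriv_sub (hA₁ 0 h0mem).contDiffAt (hA₂ 0 h0mem).contDiffAt,
        ProbabilityTheory.iteratedDeriv_complexMGF (hre 0 h0mem).1,
        ProbabilityTheory.iteratedDeriv_complexMGF (hre 0 h0mem).2]
      simp only [zero_mul, Complex.exp_zero, mul_one]
      have e : ∀ x, ((X x : ℂ)) ^ n = ((X x ^ n : ℝ) : ℂ) := fun x => by push_cast; rfl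
      simp_rw [e]
      rw [integral_complex_ofReal, integral_complex_ofReal, ← Complex.ofReal_sub]
      have hz : ∫ x, h x * X x ^ n ∂μ = 0 := by
        simp only [hX, hL]
        exact integral_mul_linear_pow_eq_zero hα hh hk c n
      have hpow : Integrable (fun x => h x * X x ^ n) μ := by
        have hi : (0 : ℝ) ∈ interior (ProbabilityTheory.integrableExpSet X ν₁) := by
          simpa using (hre 0 h0mem).1
        have hi₂ : (0 : ℝ) ∈ interior (ProbabilityTheory.integrableExpSet X ν₂) := by
          simpa using (hre 0 h0mem).2
        have h1 := ProbabilityTheory.integrable_pow_of_mem_interior_integrableExpSet hi n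
        have h2 := ProbabilityTheory.integrable_pow_of_mem_interior_integrableExpSet hi₂ n
        rw [integrable_withDensity_iff (by fun_prop) (by simp)] at h1 h2
        refine (h1.sub h2).congr (ae_of_all _ fun x => ?_)
        simp only [Pi.sub_apply, ENNReal.toReal_ofReal', ← mul_sub]
        rw [mul_comm]
        congr 1
        rcases le_total 0 (h x) with hx | hx
        · rw [max_eq_left hx, max_eq_right (by linarith), sub_zero]
        · rw [max_eq_right hx, max_eq_left (by linarith)]; ring
      rw [integral_withDensity_sub hm (Measurable.aestronglyMeasurable (by fun_prop)) hpow, hz]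
      simp
    have hev : ProbabilityTheory.complexMGF X ν₁ =ᶠ[𝓝 0] ProbabilityTheory.complexMGF X ν₂ := by
      have hA : AnalyticAt ℂ (ProbabilityTheory.complexMGF X ν₁ -
        ProbabilityTheory.complexMGF X ν₂) 0 := (hA₁ 0 h0mem).sub (hA₂ 0 h0mem)
      have htop : analyticOrderAt (ProbabilityTheory.complexMGF X ν₁ -
          ProbabilityTheory.complexMGF X ν₂) 0 = ⊤ := by
        rw [ENat.eq_top_iff_forall_ge]
        intro n
        rw [natCast_le_analyticOrderAt_iff_iteratedDeriv_eq_zero hA]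
        exact fun i _ => hder i
      rw [analyticOrderAt_eq_top] at htop
      filter_upwards [htop] with z hz
      exact sub_eq_zero.mp hz
    have hpre : IsPreconnected {z : ℂ | z.re ∈ Ioo (-ε) ε} :=
      ((convex_Ioo (-ε) ε).linear_preimage Complex.reLm).isPreconnected
    have heq := hA₁.eqOn_of_preconnected_of_eventuallyEq hA₂ hpre h0mem hev hImem
    rw [charFunDual_apply, charFunDual_apply]
    simpa [ProbabilityTheory.complexMGF, hX, mul_comm] using heq
  rw [hν₁, hν₂, withDensity_eq_iff_of_sigmaFinite (by fun_prop) (by fun_prop)] at key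
  filter_upwards [key] with x hx
  rcases le_total 0 (h x) with h0 | h0
  · rw [ENNReal.ofReal_of_nonpos (by linarith : -h x ≤ 0), ENNReal.ofReal_eq_zero] at hx
    exact le_antisymm hx h0
  · rw [ENNReal.ofReal_of_nonpos h0, eq_comm, ENNReal.ofReal_eq_zero] at hx
    exact le_antisymm h0 (neg_nonpos.mp hx)

/-- Functions of `L²(μ_α)` with the same Laguerre coefficients agree almost everywhere. -/
theorem ae_eq_of_coeff_eq (hα : ∀ i, -1 < α i) {g h : (Fin d → ℝ) → ℝ}
    (hg : MemLp g 2 (laguerreMeasure α)) (hh : MemLp h 2 (laguerreMeasure α))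
    (hk : ∀ k, ∫ x, g x * laguerrePolyProd α k x ∂(laguerreMeasure α) =
      ∫ x, h x * laguerrePolyProd α k x ∂(laguerreMeasure α)) :
    g =ᵐ[laguerreMeasure α] h := by
  have hgh := hg.sub hh
  set w := hgh.1.mk (g - h) with hw
  have hwae : (g - h) =ᵐ[laguerreMeasure α] w := hgh.1.ae_eq_mk
  have hz : w =ᵐ[laguerreMeasure α] 0 := by
    refine ae_eq_zero_of_measurable hα hgh.1.stronglyMeasurable_mk.measurable
      (hgh.ae_eq hwae) fun k => ?_
    have : (fun x => w x * laguerrePolyProd α k x) =ᵐ[laguerreMeasure α]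
        fun x => g x * laguerrePolyProd α k x - h x * laguerrePolyProd α k x := by
      filter_upwards [hwae] with x hx
      rw [← hx, Pi.sub_apply, sub_mul]
    rw [integral_congr_ae this, integral_sub (integrable_mul_laguerre hα hg k)
      (integrable_mul_laguerre hα hh k), hk k, sub_self]
  filter_upwards [hwae, hz] with x h1 h2
  rw [h2] at h1
  exact sub_eq_zero.mp h1

end

/-! ### Superpositions of functions and their Laguerre coefficients -/

section
variable {d : ℕ} {α : Fin d → ℝ}

section superposition
variable {S : Type*} [MeasurableSpace S] {ν : Measure S} [SFinite ν]
  {U : S → (Fin d → ℝ) → ℝ} {M : S → ℝ}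

lemma ae_ae_le_of_bound (hα : ∀ i, -1 < α i)
    (hU : Measurable (Function.uncurry U)) (hMm : Measurable M)
    (hb : ∀ᵐ s ∂ν, ∀ᵐ x ∂(laguerreMeasure α), |U s x| ≤ M s) :
    ∀ᵐ x ∂(laguerreMeasure α), ∀ᵐ s ∂ν, |U s x| ≤ M s := by
  have := isProbabilityMeasure_laguerreMeasure hα
  refine (Measure.ae_ae_comm (p := fun s x => |U s x| ≤ M s) ?_).mp hb
  exact measurableSet_le (continuous_abs.measurable.comp hU) (hMm.comp measurable_fst)

lemma ae_integrable_of_bound (hα : ∀ i, -1 < α i)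
    (hU : Measurable (Function.uncurry U)) (hMm : Measurable M) (hM : Integrable M ν)
    (hb : ∀ᵐ s ∂ν, ∀ᵐ x ∂(laguerreMeasure α), |U s x| ≤ M s) :
    ∀ᵐ x ∂(laguerreMeasure α), Integrable (fun s => U s x) ν := by
  filter_upwards [ae_ae_le_of_bound hα hU hMm hb] with x hx
  exact hM.mono' (hU.comp measurable_prodMk_right).aestronglyMeasurable hx

lemma ae_abs_integral_le (hα : ∀ i, -1 < α i)
    (hU : Measurable (Function.uncurry U)) (hMm : Measurable M) (hM : Integrable M ν)
    (hb : ∀ᵐ s ∂ν, ∀ᵐ x ∂(laguerreMeasure α), |U s x| ≤ M s) :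
    ∀ᵐ x ∂(laguerreMeasure α), |∫ s, U s x ∂ν| ≤ ∫ s, M s ∂ν := by
  filter_upwards [ae_ae_le_of_bound hα hU hMm hb] with x hx
  rw [← Real.norm_eq_abs]
  exact norm_integral_le_of_norm_le hM (by simpa only [Real.norm_eq_abs] using hx)

lemma measurable_integral_left (hU : Measurable (Function.uncurry U)) :
    Measurable fun x => ∫ s, U s x ∂ν :=
  (hU.stronglyMeasurable.integral_prod_left (μ := ν)).measurable

/-- Laguerre coefficients commute with superpositions. -/
lemma coeff_integral (hα : ∀ i, -1 < α i)
    (hU : Measurable (Function.uncurry U)) (hM : Integrable M ν)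
    (hb : ∀ᵐ s ∂ν, ∀ᵐ x ∂(laguerreMeasure α), |U s x| ≤ M s) (k : Fin d → ℕ) :
    ∫ x, (∫ s, U s x ∂ν) * laguerrePolyProd α k x ∂(laguerreMeasure α) =
      ∫ s, ∫ x, U s x * laguerrePolyProd α k x ∂(laguerreMeasure α) ∂ν := by
  have hprob := isProbabilityMeasure_laguerreMeasure hα
  have hL := memLp_laguerrePolyProd hα k
  have hL1 : Integrable (laguerrePolyProd α k) (laguerreMeasure α) := hL.integrable (by norm_num)
  simp_rw [← integral_mul_const]
  symm
  refine integral_integral_swap (f := fun s x => U s x * laguerrePolyProd α k x) ?_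
  have hmeas : AEStronglyMeasurable (Function.uncurry fun s x => U s x * laguerrePolyProd α k x)
      (ν.prod (laguerreMeasure α)) :=
    hU.aestronglyMeasurable.mul hL.1.comp_snd
  refine (integrable_prod_iff hmeas).mpr ⟨?_, ?_⟩
  · filter_upwards [hb] with s hs
    exact hL1.bdd_mul (c := M s) (hU.comp measurable_prodMk_left).aestronglyMeasurable hs
  · refine (hM.mul_const (∫ x, |laguerrePolyProd α k x| ∂(laguerreMeasure α))).mono'
      hmeas.norm.integral_prod_right' ?_
    filter_upwards [hb] with s hs
    rw [Real.norm_of_nonneg (integral_nonneg fun _ => norm_nonneg _), ← integral_const_mul]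
    refine integral_mono_of_nonneg (ae_of_all _ fun _ => norm_nonneg _)
      (hL1.abs.const_mul _) ?_
    filter_upwards [hs] with x hx
    simp only [Function.uncurry, norm_mul, Real.norm_eq_abs]
    exact mul_le_mul_of_nonneg_right hx (abs_nonneg _)

end superposition

/-! ### The heat semigroup on bounded functions -/

lemma laguerreHeatKernel_eq (t : ℝ) (x y : Fin d → ℝ) :
    laguerreHeatKernel α t x y = ∏ j, heatFactor (α j) t (x j) (y j) := rfl

lemma laguerreHeatKernel_comm (t : ℝ) (x y : Fin d → ℝ) :
    laguerreHeatKernel α t x y = laguerreHeatKernel α t y x := by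
  simp_rw [laguerreHeatKernel_eq]
  exact Finset.prod_congr rfl fun j _ => heatFactor_comm _ _ _ _

lemma laguerreHeatKernel_nonneg (hα : ∀ i, -1 < α i) {t : ℝ} (ht : 0 < t) {x y : Fin d → ℝ}
    (hx : ∀ i, 0 < x i) (hy : ∀ i, 0 < y i) : 0 ≤ laguerreHeatKernel α t x y :=
  Finset.prod_nonneg fun i _ => heatFactor_nonneg (hα i) ht (hx i) (hy i)

lemma measurable_besselI (ν : ℝ) : Measurable (besselI ν) := by
  unfold besselI
  refine Measurable.tsum fun m => ?_
  fun_prop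

lemma measurable_laguerreHeatKernel : Measurable fun p : ℝ × (Fin d → ℝ) × (Fin d → ℝ) =>
    laguerreHeatKernel α p.1 p.2.1 p.2.2 := by
  unfold laguerreHeatKernel
  refine Finset.measurable_prod _ fun j _ => ?_
  have := measurable_besselI (α j)
  refine Measurable.mul ?_ (this.comp ?_) <;> fun_prop

lemma measurable_laguerreHeatKernel_prod (t : ℝ) :
    Measurable fun p : (Fin d → ℝ) × (Fin d → ℝ) => laguerreHeatKernel α t p.1 p.2 := by
  have h := (measurable_laguerreHeatKernel (α := α)).comp (measurable_prodMk_left (x := t))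
  exact h

lemma measurable_laguerreHeatKernel_right (t : ℝ) (x : Fin d → ℝ) :
    Measurable (laguerreHeatKernel α t x) := by
  have h := (measurable_laguerreHeatKernel_prod (α := α) t).comp (measurable_prodMk_left (x := x))
  exact h

lemma integrable_laguerreHeatKernel (hα : ∀ i, -1 < α i) {t : ℝ} (ht : 0 < t) {x : Fin d → ℝ}
    (hx : ∀ i, 0 < x i) : Integrable (laguerreHeatKernel α t x) (laguerreMeasure α) := by
  have := integrable_prod hα (f := fun j y => heatFactor (α j) t (x j) y)
    fun i => by simpa using (heatFactor_mul_pow (hα i) ht (hx i) 0).1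
  exact this

/-- The heat semigroup is conservative. -/
lemma integral_laguerreHeatKernel (hα : ∀ i, -1 < α i) {t : ℝ} (ht : 0 < t) {x : Fin d → ℝ}
    (hx : ∀ i, 0 < x i) : ∫ y, laguerreHeatKernel α t x y ∂(laguerreMeasure α) = 1 := by
  simp_rw [laguerreHeatKernel_eq]
  rw [integral_prod hα (fun j y => heatFactor (α j) t (x j) y)]
  refine Finset.prod_eq_one fun i _ => ?_
  have := (heatFactor_mul_pow (hα i) ht (hx i) 0).2
  have h0 := (Gamma_add_one_pos (hα i) 0).ne'
  simp only [CharP.cast_eq_zero, zero_add] at h0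
  simpa [div_self h0] using this

lemma integral_laguerreHeatKernel_mul (hα : ∀ i, -1 < α i) {t : ℝ} (ht : 0 < t)
    {x : Fin d → ℝ} (hx : ∀ i, 0 < x i) (k : Fin d → ℕ) :
    ∫ y, laguerreHeatKernel α t x y * laguerrePolyProd α k y ∂(laguerreMeasure α) =
      Real.exp (-((∑ i, k i : ℕ) * t)) * laguerrePolyProd α k x := by
  simp_rw [laguerreHeatKernel_eq, laguerrePolyProd, ← Finset.prod_mul_distrib]
  rw [integral_prod hα (fun j y => heatFactor (α j) t (x j) y * laguerrePoly (α j) (k j) y)]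
  simp_rw [(heatFactor_mul_laguerrePoly (hα _) ht (hx _) _).2]
  rw [Finset.prod_mul_distrib, Finset.prod_pow_eq_pow_sum, ← Real.exp_nat_mul]
  simp only [mul_neg]

variable {f : (Fin d → ℝ) → ℝ} {M : ℝ}

lemma measurable_laguerreHeat (hα : ∀ i, -1 < α i) (hf : Measurable f) :
    Measurable fun p : ℝ × (Fin d → ℝ) => laguerreHeat α p.1 f p.2 := by
  have := isProbabilityMeasure_laguerreMeasure hα
  unfold laguerreHeat
  have h : Measurable fun q : (ℝ × (Fin d → ℝ)) × (Fin d → ℝ) =>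
      laguerreHeatKernel α q.1.1 q.1.2 q.2 * f q.2 :=
    (measurable_laguerreHeatKernel.comp (measurable_fst.fst.prodMk
      (measurable_fst.snd.prodMk measurable_snd))).mul (hf.comp measurable_snd)
  exact h.stronglyMeasurable.integral_prod_right.measurable

lemma abs_laguerreHeat_le (hα : ∀ i, -1 < α i)
    (hM : ∀ᵐ y ∂(laguerreMeasure α), |f y| ≤ M) {t : ℝ} (ht : 0 < t) {x : Fin d → ℝ}
    (hx : ∀ i, 0 < x i) : |laguerreHeat α t f x| ≤ M := by
  have h : |laguerreHeat α t f x| ≤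
      ∫ y, laguerreHeatKernel α t x y * M ∂(laguerreMeasure α) := by
    rw [← Real.norm_eq_abs]
    refine norm_integral_le_of_norm_le ((integrable_laguerreHeatKernel hα ht hx).mul_const M) ?_
    filter_upwards [ae_pos hα, hM] with y hy hfy
    have hG := laguerreHeatKernel_nonneg hα ht hx hy
    rw [norm_mul, Real.norm_of_nonneg hG]
    exact mul_le_mul_of_nonneg_left hfy hG
  rwa [integral_mul_const, integral_laguerreHeatKernel hα ht hx, one_mul] at h

/-- The heat semigroup acts on Laguerre coefficients by `e^{-t|k|}`. -/
lemma coeff_laguerreHeat (hα : ∀ i, -1 < α i) (hf : Measurable f)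
    (hM : ∀ᵐ y ∂(laguerreMeasure α), |f y| ≤ M) {t : ℝ} (ht : 0 < t) (k : Fin d → ℕ) :
    ∫ x, laguerreHeat α t f x * laguerrePolyProd α k x ∂(laguerreMeasure α) =
      Real.exp (-((∑ i, k i : ℕ) * t)) *
        ∫ x, f x * laguerrePolyProd α k x ∂(laguerreMeasure α) := by
  have hprob := isProbabilityMeasure_laguerreMeasure hα
  have hL := memLp_laguerrePolyProd hα k
  have hL1 : Integrable (laguerrePolyProd α k) (laguerreMeasure α) := hL.integrable (by norm_num)
  have hGm := measurable_laguerreHeatKernel_prod (α := α) t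
  unfold laguerreHeat
  simp_rw [← integral_mul_const]
  have hmeas : AEStronglyMeasurable (Function.uncurry fun x y =>
      laguerreHeatKernel α t x y * f y * laguerrePolyProd α k x)
      ((laguerreMeasure α).prod (laguerreMeasure α)) :=
    (hGm.mul (hf.comp measurable_snd)).aestronglyMeasurable.mul hL.1.comp_fst
  have hle : ∀ x, (∀ i, 0 < x i) → ∀ᵐ y ∂(laguerreMeasure α),
      ‖laguerreHeatKernel α t x y * f y * laguerrePolyProd α k x‖ ≤
        laguerreHeatKernel α t x y * (M * |laguerrePolyProd α k x|) := by
    intro x hx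
    filter_upwards [ae_pos hα, hM] with y hy hfy
    have hG := laguerreHeatKernel_nonneg hα ht hx hy
    rw [norm_mul, norm_mul, Real.norm_of_nonneg hG, mul_assoc]
    exact mul_le_mul_of_nonneg_left (mul_le_mul_of_nonneg_right hfy (abs_nonneg _)) hG
  have hint : ∀ x, (∀ i, 0 < x i) → Integrable (fun y => laguerreHeatKernel α t x y *
      (M * |laguerrePolyProd α k x|)) (laguerreMeasure α) := fun x hx =>
    (integrable_laguerreHeatKernel hα ht hx).mul_const _
  have hprodint : Integrable (Function.uncurry fun x y =>
      laguerreHeatKernel α t x y * f y * laguerrePolyProd α k x)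
      ((laguerreMeasure α).prod (laguerreMeasure α)) := by
    refine (integrable_prod_iff hmeas).mpr ⟨?_, ?_⟩
    · filter_upwards [ae_pos hα] with x hx
      refine (hint x hx).mono' ?_ (hle x hx)
      exact (((measurable_laguerreHeatKernel_right t x).mul hf).mul_const
        (laguerrePolyProd α k x)).aestronglyMeasurable
    · refine (hL1.abs.const_mul M).mono' hmeas.norm.integral_prod_right' ?_
      filter_upwards [ae_pos hα] with x hx
      rw [Real.norm_of_nonneg (integral_nonneg fun _ => norm_nonneg _)]
      refine (integral_mono_of_nonneg (ae_of_all _ fun _ => norm_nonneg _) (hint x hx)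
        (hle x hx)).trans_eq ?_
      rw [integral_mul_const, integral_laguerreHeatKernel hα ht hx, one_mul]
  rw [integral_integral_swap hprodint, ← integral_const_mul]
  refine integral_congr_ae ?_
  filter_upwards [ae_pos hα] with y hy
  have : ∀ x, laguerreHeatKernel α t x y * f y * laguerrePolyProd α k x =
      f y * (laguerreHeatKernel α t y x * laguerrePolyProd α k x) := by
    intro x; rw [laguerreHeatKernel_comm]; ring
  simp_rw [this]
  rw [integral_const_mul, integral_laguerreHeatKernel_mul hα ht hy]
  ring

end

/-! ### The subordination integral -/

lemma image_div_Ioi {c : ℝ} (hc : 0 < c) : (fun s : ℝ => c / s) '' Ioi 0 = Ioi 0 := by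
  ext u
  constructor
  · rintro ⟨s, hs, rfl⟩
    exact div_pos hc hs
  · intro hu
    exact ⟨c / u, div_pos hc hu, by have : u ≠ 0 := (ne_of_gt hu); field_simp⟩

lemma hasDerivWithinAt_div {c s : ℝ} (hs : s ∈ Ioi (0 : ℝ)) :
    HasDerivWithinAt (fun s : ℝ => c / s) (-(c / s ^ 2)) (Ioi 0) s := by
  have hs' : s ≠ 0 := ne_of_gt hs
  have := ((hasDerivAt_inv hs').const_mul c).hasDerivWithinAt (s := Ioi 0)
  simpa [div_eq_mul_inv] using this

lemma injOn_div {c : ℝ} (hc : 0 < c) : InjOn (fun s : ℝ => c / s) (Ioi 0) := by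
  intro s hs s' hs' h
  have h1 : s ≠ 0 := ne_of_gt hs
  have h2 : s' ≠ 0 := ne_of_gt hs'
  field_simp at h
  exact h.symm

lemma abs_neg_div_sq {c : ℝ} (hc : 0 < c) (s : ℝ) : |-(c / s ^ 2)| = c / s ^ 2 := by
  rw [abs_neg, abs_of_nonneg (by positivity)]

/-- The inversion `u = c / s` in an integral over the half-line. -/
lemma integral_inversion {c : ℝ} (hc : 0 < c) (g : ℝ → ℝ) :
    ∫ u in Ioi 0, g u = ∫ s in Ioi 0, c / s ^ 2 * g (c / s) := by
  have := integral_image_eq_integral_abs_deriv_smul measurableSet_Ioi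
    (fun s hs => hasDerivWithinAt_div (c := c) hs) (injOn_div hc) g
  rw [image_div_Ioi hc] at this
  simpa only [abs_neg_div_sq hc, smul_eq_mul] using this

lemma integrableOn_inversion {c : ℝ} (hc : 0 < c) (g : ℝ → ℝ) :
    IntegrableOn g (Ioi 0) ↔ IntegrableOn (fun s => c / s ^ 2 * g (c / s)) (Ioi 0) := by
  have := integrableOn_image_iff_integrableOn_abs_deriv_smul measurableSet_Ioi
    (fun s hs => hasDerivWithinAt_div (c := c) hs) (injOn_div hc) g
  rw [image_div_Ioi hc] at this
  simpa only [abs_neg_div_sq hc, smul_eq_mul] using this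

lemma integrableOn_exp_div_sqrt : IntegrableOn (fun u : ℝ => Real.exp (-u) / √u) (Ioi 0) := by
  refine (integrableOn_rpow_mul_exp (c := 1 / 2) (b := 1) (by norm_num) one_pos).congr_fun
    (fun u hu => ?_) measurableSet_Ioi
  have hu : 0 < u := hu
  simp only [one_mul]
  rw [show (1 / 2 - 1 : ℝ) = -(1 / 2) by norm_num, Real.rpow_neg hu.le, Real.sqrt_eq_rpow]
  ring

lemma integral_exp_div_sqrt : ∫ u in Ioi (0 : ℝ), Real.exp (-u) / √u = √Real.pi := by
  rw [← Real.Gamma_one_half_eq, Real.Gamma_eq_integral (by norm_num)]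
  refine setIntegral_congr_fun measurableSet_Ioi fun u hu => ?_
  have hu : 0 < u := hu
  rw [show (1 / 2 - 1 : ℝ) = -(1 / 2) by norm_num, Real.rpow_neg hu.le, Real.sqrt_eq_rpow]
  ring

/-- The substitution `w = √u - c / √u` maps the half-line onto the line. -/
lemma image_sqrt_sub_div {c : ℝ} (hc : 0 < c) : (fun u : ℝ => √u - c / √u) '' Ioi 0 = univ := by
  refine eq_univ_of_forall fun y => ?_
  set v := (y + √(y ^ 2 + 4 * c)) / 2 with hv
  have hs : √(y ^ 2 + 4 * c) ^ 2 = y ^ 2 + 4 * c := Real.sq_sqrt (by positivity)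
  have h1 : |y| < √(y ^ 2 + 4 * c) := by
    rw [← Real.sqrt_sq_eq_abs]
    exact Real.sqrt_lt_sqrt (sq_nonneg _) (by linarith)
  have hv0 : 0 < v := by have := neg_abs_le y; rw [hv]; linarith
  refine ⟨v ^ 2, by simpa using pow_pos hv0 2, ?_⟩
  simp only [Real.sqrt_sq hv0.le]
  field_simp
  rw [hv]
  nlinarith

lemma strictMonoOn_sqrt_sub_div {c : ℝ} (hc : 0 < c) :
    StrictMonoOn (fun u : ℝ => √u - c / √u) (Ioi 0) := by
  intro u hu v hv huv
  have hu : 0 < u := hu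
  have h1 : √u < √v := Real.sqrt_lt_sqrt hu.le huv
  have h2 : 0 < √u := Real.sqrt_pos.mpr hu
  have h3 : c / √v < c / √u := div_lt_div_of_pos_left hc h2 h1
  simp only
  linarith

lemma hasDerivWithinAt_sqrt_sub_div {c u : ℝ} (hu : u ∈ Ioi (0 : ℝ)) :
    HasDerivWithinAt (fun u : ℝ => √u - c / √u) ((1 / √u + c / (u * √u)) / 2) (Ioi 0) u := by
  have hu : 0 < u := hu
  have h2 : 0 < √u := Real.sqrt_pos.mpr hu
  have h := Real.hasDerivAt_sqrt hu.ne'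
  have h3 := (h.sub ((h.inv h2.ne').const_mul c)).hasDerivWithinAt (s := Ioi 0)
  have hsq : √u ^ 2 = u := Real.sq_sqrt hu.le
  convert! h3 using 1
  rw [hsq]
  field_simp
  ring

lemma exp_sqrt_sub_div {c u : ℝ} (hu : 0 < u) :
    Real.exp (-(√u - c / √u) ^ 2) =
      Real.exp (2 * c) * (Real.exp (-u) * Real.exp (-(c ^ 2 / u))) := by
  have h2 : 0 < √u := Real.sqrt_pos.mpr hu
  have hsq : √u ^ 2 = u := Real.sq_sqrt hu.le
  rw [← Real.exp_add, ← Real.exp_add]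
  congr 1
  rw [sub_sq, div_pow, hsq]
  field_simp
  ring

/-- The classical subordination integral. With `w = √u - c / √u` the integrand is
`e^{-2c} u^{-1/2} e^{-w²}`, the inversion `u ↦ c² / u` turns `u^{-1/2} du` into `c u^{-3/2} du`,
and half the sum of both is `dw`. -/
lemma integral_subordination {c : ℝ} (hc : 0 ≤ c) :
    ∫ u in Ioi (0 : ℝ), Real.exp (-u) / √u * Real.exp (-(c ^ 2 / u)) =
      √Real.pi * Real.exp (-(2 * c)) := by
  rcases eq_or_lt_of_le hc with rfl | hc
  · simp [integral_exp_div_sqrt]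
  set w : ℝ → ℝ := fun u => √u - c / √u with hw
  set g : ℝ → ℝ := fun u => Real.exp (-u) / √u * Real.exp (-(c ^ 2 / u)) with hg
  have hgi : IntegrableOn g (Ioi 0) := by
    refine Integrable.mono' integrableOn_exp_div_sqrt
      (Measurable.aestronglyMeasurable (by fun_prop)) ?_
    filter_upwards [ae_restrict_mem measurableSet_Ioi] with u hu
    have hu : 0 < u := hu
    rw [Real.norm_of_nonneg (by positivity)]
    refine mul_le_of_le_one_right (by positivity) ?_
    rw [Real.exp_le_one_iff]
    have : 0 ≤ c ^ 2 / u := by positivity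
    linarith
  have hinv : ∀ u ∈ Ioi (0 : ℝ), c ^ 2 / u ^ 2 * g (c ^ 2 / u) =
      c / (u * √u) * (Real.exp (-u) * Real.exp (-(c ^ 2 / u))) := by
    intro u hu
    have hu : 0 < u := hu
    have h2 : 0 < √u := Real.sqrt_pos.mpr hu
    have hsq : √u ^ 2 = u := Real.sq_sqrt hu.le
    simp only [hg]
    rw [Real.sqrt_div (by positivity), Real.sqrt_sq hc.le,
      show c ^ 2 / (c ^ 2 / u) = u by field_simp]
    have : c ^ 2 / u ^ 2 / (c / √u) = c / (u * √u) := by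
      field_simp
      rw [hsq]
    rw [← this]
    field_simp
  have h1 : ∫ x : ℝ, Real.exp (-x ^ 2) = √Real.pi := by
    simpa using integral_gaussian 1
  have h2 := integral_image_eq_integral_abs_deriv_smul measurableSet_Ioi
    (fun u hu => hasDerivWithinAt_sqrt_sub_div (c := c) hu)
    (strictMonoOn_sqrt_sub_div hc).injOn (fun x => Real.exp (-x ^ 2))
  rw [image_sqrt_sub_div hc, Measure.restrict_univ, h1] at h2
  have h3 : ∀ u ∈ Ioi (0 : ℝ), |(1 / √u + c / (u * √u)) / 2| • Real.exp (-(√u - c / √u) ^ 2) =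
      Real.exp (2 * c) / 2 * (g u + c ^ 2 / u ^ 2 * g (c ^ 2 / u)) := by
    intro u hu
    rw [hinv u hu]
    have hu : 0 < u := hu
    have h2 : 0 < √u := Real.sqrt_pos.mpr hu
    rw [abs_of_nonneg (by positivity), exp_sqrt_sub_div hu, smul_eq_mul]
    simp only [hg]
    ring
  rw [setIntegral_congr_fun measurableSet_Ioi h3, integral_const_mul,
    integral_add hgi ((integrableOn_inversion (by positivity) g).mp hgi),
    ← integral_inversion (by positivity) g] at h2
  rw [h2, Real.exp_neg]
  have := Real.exp_pos (2 * c)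
  field_simp
  ring

/-! ### Subordinated functions and their derivatives -/

/-- The polynomials `Q_j` for which
`∂_t^j (t e^{-t²/4s}) = t^{1-j} Q_j(t²/4s) e^{-t²/4s}`. -/
noncomputable def subPoly : ℕ → Polynomial ℝ
  | 0 => 1
  | j + 1 => Polynomial.C (1 - (j : ℝ)) * subPoly j +
      2 * Polynomial.X * Polynomial.derivative (subPoly j) - 2 * Polynomial.X * subPoly j

/-- The `j`-th derivative at `t` of the function subordinated to `φ`: for `j = 0` this is
`π^{-1/2} ∫_0^∞ e^{-u} u^{-1/2} φ(t²/4u) du`. -/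
noncomputable def subord (j : ℕ) (φ : ℝ → ℝ) (t : ℝ) : ℝ :=
  1 / √Real.pi * ((t ^ j)⁻¹ *
    ∫ u in Ioi (0 : ℝ), (subPoly j).eval u * (Real.exp (-u) / √u) * φ (t ^ 2 / (4 * u)))

lemma exists_polynomial_le_exp (p : Polynomial ℝ) :
    ∃ C : ℝ, 0 ≤ C ∧ ∀ w : ℝ, 0 ≤ w → |p.eval w| ≤ C * Real.exp (w / 2) := by
  induction p using Polynomial.induction_on' with
  | add p q hp hq =>
    obtain ⟨C, hC, h1⟩ := hp
    obtain ⟨D, hD, h2⟩ := hq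
    refine ⟨C + D, by positivity, fun w hw => ?_⟩
    rw [Polynomial.eval_add, add_mul]
    exact (abs_add_le _ _).trans (add_le_add (h1 w hw) (h2 w hw))
  | monomial n a =>
    refine ⟨|a| * (2 ^ n * n.factorial), by positivity, fun w hw => ?_⟩
    have h := Real.pow_div_factorial_le_exp (w / 2) (by positivity) n
    rw [div_le_iff₀ (by positivity), div_pow, div_le_iff₀ (by positivity)] at h
    rw [Polynomial.eval_monomial, abs_mul, abs_of_nonneg (pow_nonneg hw n), mul_assoc]
    refine mul_le_mul_of_nonneg_left (h.trans_eq (by ring)) (abs_nonneg _)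

lemma integrableOn_subPoly (p : Polynomial ℝ) :
    IntegrableOn (fun u : ℝ => p.eval u * (Real.exp (-u) / √u)) (Ioi 0) := by
  obtain ⟨C, hC, h⟩ := exists_polynomial_le_exp p
  have h2 : IntegrableOn (fun u : ℝ => C * (u ^ ((1 / 2 : ℝ) - 1) * Real.exp (-(1 / 2 * u))))
      (Ioi 0) :=
    (integrableOn_rpow_mul_exp (c := 1 / 2) (b := 1 / 2) (by norm_num) (by norm_num)).const_mul C
  refine Integrable.mono' h2 (Measurable.aestronglyMeasurable ?_) ?_
  · have := p.continuous.measurable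
    fun_prop
  filter_upwards [ae_restrict_mem measurableSet_Ioi] with u hu
  have hu : 0 < u := hu
  rw [norm_mul, Real.norm_eq_abs, Real.norm_of_nonneg (by positivity)]
  refine (mul_le_mul_of_nonneg_right (h u hu.le) (by positivity)).trans_eq ?_
  rw [show (1 / 2 - 1 : ℝ) = -(1 / 2) by norm_num, Real.rpow_neg hu.le, ← Real.sqrt_eq_rpow,
    show Real.exp (-u) = Real.exp (-(1 / 2 * u)) * Real.exp (-(1 / 2 * u)) by
      rw [← Real.exp_add]; congr 1; ring,
    show Real.exp (u / 2) = (Real.exp (-(1 / 2 * u)))⁻¹ by rw [← Real.exp_neg]; congr 1; ring]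
  have := Real.exp_pos (-(1 / 2 * u))
  field_simp

/-- The constant in the bound `subConst j * t ^ (-j)` for the norm of the `j`-th time derivative of
the subordinated semigroup. -/
noncomputable def subConst (j : ℕ) : ℝ :=
  1 / √Real.pi * ∫ u in Ioi (0 : ℝ), |(subPoly j).eval u| * (Real.exp (-u) / √u)

lemma subConst_nonneg (j : ℕ) : 0 ≤ subConst j :=
  mul_nonneg (by positivity) (integral_nonneg fun _ => by positivity)

lemma abs_subord_le {φ : ℝ → ℝ} {M : ℝ} (hM : ∀ s, 0 < s → |φ s| ≤ M) (j : ℕ) {t : ℝ}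
    (ht : 0 < t) : |subord j φ t| ≤ subConst j * (t ^ j)⁻¹ * M := by
  have hint : IntegrableOn (fun u : ℝ => |(subPoly j).eval u| * (Real.exp (-u) / √u) * M)
      (Ioi 0) := by
    refine Integrable.mul_const ?_ M
    refine (integrableOn_subPoly (subPoly j)).norm.congr (ae_of_all _ fun u => ?_)
    simp only [norm_mul, Real.norm_eq_abs]
    rw [abs_of_nonneg (a := Real.exp (-u) / √u) (by positivity)]
  have h : ‖∫ u in Ioi (0 : ℝ), (subPoly j).eval u * (Real.exp (-u) / √u) * φ (t ^ 2 / (4 * u))‖ ≤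
      ∫ u in Ioi (0 : ℝ), |(subPoly j).eval u| * (Real.exp (-u) / √u) * M := by
    refine norm_integral_le_of_norm_le hint ?_
    filter_upwards [ae_restrict_mem measurableSet_Ioi] with u hu
    have hu : 0 < u := hu
    rw [norm_mul, norm_mul, Real.norm_eq_abs, Real.norm_of_nonneg (by positivity)]
    exact mul_le_mul_of_nonneg_left (hM _ (by positivity)) (by positivity)
  rw [integral_mul_const, Real.norm_eq_abs] at h
  unfold subord subConst
  rw [abs_mul, abs_mul, abs_of_nonneg (by positivity),
    abs_of_nonneg (a := (t ^ j)⁻¹) (by positivity)]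
  calc _ ≤ 1 / √Real.pi * ((t ^ j)⁻¹ *
      ((∫ u in Ioi (0 : ℝ), |(subPoly j).eval u| * (Real.exp (-u) / √u)) * M)) := by gcongr
    _ = _ := by ring

/-- The subordination integral in the variable `s = t² / 4u`. -/
lemma subord_eq {φ : ℝ → ℝ} (j : ℕ) {t : ℝ} (ht : 0 < t) :
    subord j φ t = 1 / (2 * √Real.pi) * ∫ s in Ioi (0 : ℝ),
      t * (t ^ j)⁻¹ * ((subPoly j).eval (t ^ 2 / (4 * s)) * Real.exp (-(t ^ 2 / (4 * s)))) *
        ((s * √s)⁻¹ * φ s) := by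
  unfold subord
  rw [integral_inversion (c := t ^ 2 / 4) (by positivity), ← integral_const_mul,
    ← integral_const_mul, ← integral_const_mul]
  refine setIntegral_congr_fun measurableSet_Ioi fun s hs => ?_
  have hs : 0 < s := hs
  have h2 : 0 < √s := Real.sqrt_pos.mpr hs
  have hsq : √s ^ 2 = s := Real.sq_sqrt hs.le
  have e1 : t ^ 2 / 4 / s = t ^ 2 / (4 * s) := by field_simp
  have e2 : t ^ 2 / (4 * (t ^ 2 / (4 * s))) = s := by field_simp
  have e3 : √(t ^ 2 / (4 * s)) = t / (2 * √s) := by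
    rw [Real.sqrt_div (by positivity), Real.sqrt_sq ht.le, Real.sqrt_mul (by norm_num),
      show (4 : ℝ) = 2 ^ 2 by norm_num, Real.sqrt_sq (by norm_num)]
  rw [e1, e2, e3]
  have e4 : t ^ 2 / 4 / s ^ 2 / (t / (2 * √s)) = 1 / 2 * (t * (s * √s)⁻¹) := by
    field_simp
    rw [hsq]
    ring
  calc _ = 1 / √Real.pi * ((t ^ j)⁻¹ * (t ^ 2 / 4 / s ^ 2 / (t / (2 * √s)) *
        ((subPoly j).eval (t ^ 2 / (4 * s)) * Real.exp (-(t ^ 2 / (4 * s))) * φ s))) := by ring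
    _ = _ := by rw [e4]; ring

lemma integrableOn_exp_inv {c : ℝ} (hc : 0 < c) :
    IntegrableOn (fun s : ℝ => (s * √s)⁻¹ * Real.exp (-(c / s))) (Ioi 0) := by
  have h := (integrableOn_inversion hc _).mp integrableOn_exp_div_sqrt
  refine IntegrableOn.congr_fun (Integrable.const_mul h (1 / √c)) (fun s hs => ?_)
    measurableSet_Ioi
  have hs : 0 < s := hs
  have h2 : 0 < √s := Real.sqrt_pos.mpr hs
  have hsq : √s ^ 2 = s := Real.sq_sqrt hs.le
  have h3 : 0 < √c := Real.sqrt_pos.mpr hc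
  have hcq : √c ^ 2 = c := Real.sq_sqrt hc.le
  rw [Real.sqrt_div hc.le]
  field_simp
  rw [hcq, hsq]

lemma hasDerivAt_subord_kernel (j : ℕ) {t s : ℝ} (ht : 0 < t) (hs : 0 < s) :
    HasDerivAt (fun t : ℝ => t * (t ^ j)⁻¹ *
      ((subPoly j).eval (t ^ 2 / (4 * s)) * Real.exp (-(t ^ 2 / (4 * s)))))
      (t * (t ^ (j + 1))⁻¹ *
      ((subPoly (j + 1)).eval (t ^ 2 / (4 * s)) * Real.exp (-(t ^ 2 / (4 * s))))) t := by
  have hw : HasDerivAt (fun t : ℝ => t ^ 2 / (4 * s)) (2 * t / (4 * s)) t := by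
    simpa using (hasDerivAt_pow 2 t).div_const (4 * s)
  have h1 : HasDerivAt (fun t : ℝ => (subPoly j).eval (t ^ 2 / (4 * s)))
      ((subPoly j).derivative.eval (t ^ 2 / (4 * s)) * (2 * t / (4 * s))) t := by
    have h := ((subPoly j).hasDerivAt (t ^ 2 / (4 * s))).comp t hw
    exact h
  have h2 : HasDerivAt (fun t : ℝ => Real.exp (-(t ^ 2 / (4 * s))))
      (Real.exp (-(t ^ 2 / (4 * s))) * -(2 * t / (4 * s))) t := hw.neg.exp
  have h3 : HasDerivAt (fun t : ℝ => t * (t ^ j)⁻¹)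
      (1 * (t ^ j)⁻¹ + t * (-(j * t ^ (j - 1)) / (t ^ j) ^ 2)) t :=
    (hasDerivAt_id t).mul ((hasDerivAt_pow j t).inv (pow_pos ht j).ne')
  have h4 := h3.mul (h1.mul h2)
  convert! h4 using 1
  simp only [Pi.mul_apply, subPoly, Polynomial.eval_sub, Polynomial.eval_add, Polynomial.eval_mul,
    Polynomial.eval_C, Polynomial.eval_X, Polynomial.eval_ofNat]
  have htj : t ^ j ≠ 0 := (pow_pos ht j).ne'
  have e : (j : ℝ) * t ^ (j - 1) * t = j * t ^ j := by
    rcases j with _ | j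
    · simp
    · simp only [Nat.add_sub_cancel, pow_succ]; ring
  have e' : t * (-(↑j * t ^ (j - 1)) / (t ^ j) ^ 2) = -(j : ℝ) * (t ^ j)⁻¹ := by
    have : t * (-(↑j * t ^ (j - 1)) / (t ^ j) ^ 2) =
        -((j : ℝ) * t ^ (j - 1) * t) / (t ^ j) ^ 2 := by
      ring
    rw [this, e]
    field_simp
  rw [e']
  simp only [pow_succ]
  field_simp
  ring

/-- Differentiation under the subordination integral. -/
lemma hasDerivAt_subord {φ : ℝ → ℝ} {M : ℝ} (hφ : Measurable φ) (hM : ∀ s, 0 < s → |φ s| ≤ M)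
    (j : ℕ) {t : ℝ} (ht : 0 < t) : HasDerivAt (subord j φ) (subord (j + 1) φ t) t := by
  set K : ℕ → ℝ → ℝ → ℝ := fun j t s => t * (t ^ j)⁻¹ *
    ((subPoly j).eval (t ^ 2 / (4 * s)) * Real.exp (-(t ^ 2 / (4 * s)))) *
      ((s * √s)⁻¹ * φ s) with hK
  have hM0 : 0 ≤ M := (abs_nonneg _).trans (hM 1 one_pos)
  have hmeas : ∀ j t, Measurable (K j t) := by
    intro j t
    have := (subPoly j).continuous.measurable
    simp only [hK]
    fun_prop
  have hbound : ∀ j, ∃ C, 0 ≤ C ∧ ∀ τ ∈ Ioo (t / 2) (2 * t), ∀ s, 0 < s →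
      ‖K j τ s‖ ≤ C * ((s * √s)⁻¹ * Real.exp (-(t ^ 2 / 32 / s))) := by
    intro j
    obtain ⟨C, hC, h⟩ := exists_polynomial_le_exp (subPoly j)
    refine ⟨2 * t * ((t / 2) ^ j)⁻¹ * C * M, by positivity, fun τ hτ s hs => ?_⟩
    have hτ0 : 0 < τ := by linarith [hτ.1]
    have h2 : 0 < √s := Real.sqrt_pos.mpr hs
    simp only [hK]
    rw [norm_mul, norm_mul (τ * (τ ^ j)⁻¹), norm_mul (Polynomial.eval _ _),
      norm_mul (s * √s)⁻¹, Real.norm_of_nonneg (r := τ * (τ ^ j)⁻¹) (by positivity),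
      Real.norm_of_nonneg (Real.exp_pos _).le,
      Real.norm_of_nonneg (r := (s * √s)⁻¹) (by positivity)]
    have h3 : ‖(subPoly j).eval (τ ^ 2 / (4 * s))‖ * Real.exp (-(τ ^ 2 / (4 * s))) ≤
        C * Real.exp (-(t ^ 2 / 32 / s)) := by
      refine (mul_le_mul_of_nonneg_right (h _ (by positivity)) (Real.exp_pos _).le).trans ?_
      rw [mul_assoc, ← Real.exp_add]
      refine mul_le_mul_of_nonneg_left (Real.exp_le_exp.mpr ?_) hC
      have : t ^ 2 / 32 / s ≤ τ ^ 2 / (4 * s) / 2 := by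
        rw [div_div, div_div, div_le_div_iff₀ (by positivity) (by positivity)]
        have h5 : t ^ 2 ≤ 4 * τ ^ 2 := by nlinarith [hτ.1]
        nlinarith
      linarith
    have h4 : τ * (τ ^ j)⁻¹ ≤ 2 * t * ((t / 2) ^ j)⁻¹ := by
      have h5 : (t / 2) ^ j ≤ τ ^ j := pow_le_pow_left₀ (by positivity) hτ.1.le j
      have h6 : (τ ^ j)⁻¹ ≤ ((t / 2) ^ j)⁻¹ := inv_anti₀ (by positivity) h5
      exact mul_le_mul hτ.2.le h6 (by positivity) (by positivity)
    calc _ ≤ (2 * t * ((t / 2) ^ j)⁻¹) * (C * Real.exp (-(t ^ 2 / 32 / s))) *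
          ((s * √s)⁻¹ * M) := by
          refine mul_le_mul (mul_le_mul h4 h3 (by positivity) (by positivity))
            (mul_le_mul_of_nonneg_left (hM s hs) (by positivity)) (by positivity) (by positivity)
      _ = _ := by ring
  have hint : IntegrableOn (fun s : ℝ => (s * √s)⁻¹ * Real.exp (-(t ^ 2 / 32 / s))) (Ioi 0) :=
    integrableOn_exp_inv (by positivity)
  have hnhds : Ioo (t / 2) (2 * t) ∈ 𝓝 t := Ioo_mem_nhds (by linarith) (by linarith)
  obtain ⟨C₀, hC₀, h₀⟩ := hbound j
  obtain ⟨C₁, hC₁, h₁⟩ := hbound (j + 1)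
  have key := (hasDerivAt_integral_of_dominated_loc_of_deriv_le (μ := volume.restrict (Ioi 0))
    (F := K j) (F' := K (j + 1)) (x₀ := t) hnhds
    (Eventually.of_forall fun τ => (hmeas j τ).aestronglyMeasurable)
    (Integrable.mono' (hint.const_mul C₀) (hmeas j t).aestronglyMeasurable
      ((ae_restrict_mem measurableSet_Ioi).mono fun s hs =>
        h₀ t ⟨by linarith, by linarith⟩ s hs))
    (hmeas (j + 1) t).aestronglyMeasurable
    ((ae_restrict_mem measurableSet_Ioi).mono fun s hs τ hτ => h₁ τ hτ s hs)
    (hint.const_mul C₁)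
    ((ae_restrict_mem measurableSet_Ioi).mono fun s hs τ hτ =>
      (hasDerivAt_subord_kernel j (by linarith [hτ.1]) hs).mul_const _)).2
  rw [subord_eq (j + 1) ht]
  refine (key.const_mul (1 / (2 * √Real.pi))).congr_of_eventuallyEq ?_
  filter_upwards [Ioi_mem_nhds ht] with τ hτ
  exact subord_eq j hτ

lemma iteratedDeriv_eq_subord {F φ : ℝ → ℝ} {M : ℝ} (hφ : Measurable φ)
    (hM : ∀ s, 0 < s → |φ s| ≤ M) (hF : ∀ t, 0 < t → F t = subord 0 φ t) (j : ℕ) {t : ℝ}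
    (ht : 0 < t) : iteratedDeriv j F t = subord j φ t := by
  induction j generalizing t with
  | zero => simpa using hF t ht
  | succ j ih =>
    rw [iteratedDeriv_succ]
    refine HasDerivAt.deriv ((hasDerivAt_subord hφ hM j ht).congr_of_eventuallyEq ?_)
    filter_upwards [Ioi_mem_nhds ht] with τ hτ using ih hτ

lemma subord_exp {ξ : ℝ} (hξ : 0 ≤ ξ) (j : ℕ) {t : ℝ} (ht : 0 < t) :
    subord j (fun s => Real.exp (-(ξ ^ 2 * s))) t = (-ξ) ^ j * Real.exp (-(ξ * t)) := by
  have h0 : ∀ t, 0 < t →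
      Real.exp (-ξ * t) = subord 0 (fun s => Real.exp (-(ξ ^ 2 * s))) t := by
    intro t ht
    have h := integral_subordination (c := ξ * t / 2) (by positivity)
    unfold subord
    have e : ∀ u : ℝ, ξ ^ 2 * (t ^ 2 / (4 * u)) = (ξ * t / 2) ^ 2 / u := by
      intro u; ring
    simp only [subPoly, Polynomial.eval_one, one_mul, pow_zero, inv_one, e]
    rw [h]
    have : 0 < √Real.pi := Real.sqrt_pos.mpr Real.pi_pos
    rw [show 2 * (ξ * t / 2) = ξ * t by ring, neg_mul]
    field_simp
  rw [← iteratedDeriv_eq_subord (F := fun t => Real.exp (-ξ * t)) (M := 1) (by fun_prop)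
    (fun s hs => ?_) h0 j ht]
  · rw [iteratedDeriv_exp_const_mul]
    simp
  · rw [abs_of_nonneg (Real.exp_pos _).le, Real.exp_le_one_iff]
    have : 0 ≤ ξ ^ 2 * s := by positivity
    linarith

section
variable {d : ℕ} {α : Fin d → ℝ} {f : (Fin d → ℝ) → ℝ} {M : ℝ}

/-! ### Time derivatives of the Poisson semigroup -/

lemma memLp_of_ae_bound (hα : ∀ i, -1 < α i) (hf : Measurable f)
    (hM : ∀ᵐ y ∂(laguerreMeasure α), |f y| ≤ M) (p : ENNReal) : MemLp f p (laguerreMeasure α) := by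
  have := isProbabilityMeasure_laguerreMeasure hα
  exact MemLp.of_bound hf.aestronglyMeasurable M hM

/-- The `j`-th time derivative of the Poisson semigroup, as an integral. -/
noncomputable def poissonDeriv (α : Fin d → ℝ) (j : ℕ) (t : ℝ) (f : (Fin d → ℝ) → ℝ)
    (x : Fin d → ℝ) : ℝ :=
  subord j (fun s => laguerreHeat α s f x) t

lemma laguerrePoisson_eq (t : ℝ) (f : (Fin d → ℝ) → ℝ) (x : Fin d → ℝ) :
    laguerrePoisson α t f x = poissonDeriv α 0 t f x := by
  simp [laguerrePoisson, poissonDeriv, subord, subPoly]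

lemma measurable_laguerreHeat_left (hα : ∀ i, -1 < α i) (hf : Measurable f) (x : Fin d → ℝ) :
    Measurable fun s => laguerreHeat α s f x := by
  have h := (measurable_laguerreHeat hα hf).comp (measurable_prodMk_right (y := x))
  exact h

lemma iteratedDeriv_laguerrePoisson (hα : ∀ i, -1 < α i) (hf : Measurable f)
    (hM : ∀ᵐ y ∂(laguerreMeasure α), |f y| ≤ M) (j : ℕ) {t : ℝ} (ht : 0 < t) {x : Fin d → ℝ}
    (hx : ∀ i, 0 < x i) :
    iteratedDeriv j (fun s => laguerrePoisson α s f x) t = poissonDeriv α j t f x :=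
  iteratedDeriv_eq_subord (measurable_laguerreHeat_left hα hf x)
    (fun _ hs => abs_laguerreHeat_le hα hM hs hx) (fun t _ => laguerrePoisson_eq t f x) j ht

lemma measurable_poissonDeriv (hα : ∀ i, -1 < α i) (hf : Measurable f) (j : ℕ) :
    Measurable fun p : ℝ × (Fin d → ℝ) => poissonDeriv α j p.1 f p.2 := by
  unfold poissonDeriv subord
  have h : Measurable fun q : (ℝ × (Fin d → ℝ)) × ℝ =>
      (subPoly j).eval q.2 * (Real.exp (-q.2) / √q.2) *
        laguerreHeat α (q.1.1 ^ 2 / (4 * q.2)) f q.1.2 := by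
    have h1 := (subPoly j).continuous.measurable
    have h2 : Measurable fun q : (ℝ × (Fin d → ℝ)) × ℝ => (q.1.1 ^ 2 / (4 * q.2), q.1.2) := by
      fun_prop
    have h3 := (measurable_laguerreHeat hα hf).comp h2
    refine Measurable.mul (by fun_prop) ?_
    exact h3
  have h4 := (h.stronglyMeasurable.integral_prod_right' (ν := volume.restrict (Ioi 0))).measurable
  refine Measurable.const_mul (Measurable.mul (by fun_prop) ?_) _
  exact h4

lemma measurable_poissonDeriv_right (hα : ∀ i, -1 < α i) (hf : Measurable f) (j : ℕ) (t : ℝ) :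
    Measurable (poissonDeriv α j t f) := by
  have h := (measurable_poissonDeriv hα hf j).comp (measurable_prodMk_left (x := t))
  exact h

lemma abs_poissonDeriv_le (hα : ∀ i, -1 < α i)
    (hM : ∀ᵐ y ∂(laguerreMeasure α), |f y| ≤ M) (j : ℕ) {t : ℝ} (ht : 0 < t) :
    ∀ᵐ x ∂(laguerreMeasure α), |poissonDeriv α j t f x| ≤ subConst j * (t ^ j)⁻¹ * M := by
  filter_upwards [ae_pos hα] with x hx
  exact abs_subord_le (fun s hs => abs_laguerreHeat_le hα hM hs hx) j ht

lemma measurable_comp_heat (hα : ∀ i, -1 < α i) (hf : Measurable f) {w τ : ℝ → ℝ}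
    (hw : Measurable w) (hτ : Measurable τ) :
    Measurable (Function.uncurry fun u x => w u * laguerreHeat α (τ u) f x) := by
  have h2 : Measurable fun q : ℝ × (Fin d → ℝ) => (τ q.1, q.2) := by fun_prop
  have h3 := (measurable_laguerreHeat hα hf).comp h2
  refine Measurable.mul (by fun_prop) ?_
  exact h3

lemma coeff_poissonDeriv (hα : ∀ i, -1 < α i) (hf : Measurable f)
    (hM : ∀ᵐ y ∂(laguerreMeasure α), |f y| ≤ M) (j : ℕ) {t : ℝ} (ht : 0 < t) (k : Fin d → ℕ) :
    ∫ x, poissonDeriv α j t f x * laguerrePolyProd α k x ∂(laguerreMeasure α) =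
      (-√(∑ i, k i : ℕ)) ^ j * Real.exp (-(√(∑ i, k i : ℕ) * t)) *
        ∫ x, f x * laguerrePolyProd α k x ∂(laguerreMeasure α) := by
  rw [← subord_exp (Real.sqrt_nonneg _) j ht]
  have hp := (subPoly j).continuous.measurable
  have hint : Integrable (fun u : ℝ => |(subPoly j).eval u * (Real.exp (-u) / √u)| * M)
      (volume.restrict (Ioi 0)) :=
    (integrableOn_subPoly (subPoly j)).norm.mul_const M
  have key := coeff_integral (ν := volume.restrict (Ioi 0)) hα
    (measurable_comp_heat (w := fun u => (subPoly j).eval u * (Real.exp (-u) / √u))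
      (τ := fun u => t ^ 2 / (4 * u)) hα hf (by fun_prop) (by fun_prop))
    hint ?_ k
  · unfold poissonDeriv subord
    simp_rw [mul_assoc (1 / √Real.pi), mul_assoc ((t ^ j)⁻¹)]
    rw [integral_const_mul, integral_const_mul, key, ← integral_mul_const]
    congr 2
    refine setIntegral_congr_fun measurableSet_Ioi fun u hu => ?_
    have hu : 0 < u := hu
    simp_rw [mul_assoc ((subPoly j).eval u * (Real.exp (-u) / √u))]
    rw [integral_const_mul, coeff_laguerreHeat hα hf hM (by positivity),
      Real.sq_sqrt (Nat.cast_nonneg _)]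
  · filter_upwards [ae_restrict_mem measurableSet_Ioi] with u hu
    have hu : 0 < u := hu
    filter_upwards [ae_pos hα] with x hx
    rw [abs_mul]
    exact mul_le_mul_of_nonneg_left (abs_laguerreHeat_le hα hM (by positivity) hx) (abs_nonneg _)

/-- A bound `t^{-k+β}` for the `k`-th time derivative gives the bound `t^{-n+β}` for the `n`-th
one, `n ≥ k`: the `n`-th derivative at `t` is the `(n-k)`-th one at `t/2` of the semigroup applied
to the `k`-th one at `t/2`, as the Laguerre coefficients show. -/
lemma abs_poissonDeriv_le_of_le (hα : ∀ i, -1 < α i) (hf : Measurable f)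
    (hM : ∀ᵐ y ∂(laguerreMeasure α), |f y| ≤ M) {k n : ℕ} (hkn : k ≤ n) {A β : ℝ}
    (hA : ∀ t, 0 < t → ∀ᵐ x ∂(laguerreMeasure α),
      |poissonDeriv α k t f x| ≤ A * t ^ (-(k : ℝ) + β)) {t : ℝ} (ht : 0 < t) :
    ∀ᵐ x ∂(laguerreMeasure α), |poissonDeriv α n t f x| ≤
      subConst (n - k) * 2 ^ ((n : ℝ) - β) * A * t ^ (-(n : ℝ) + β) := by
  have ht2 : 0 < t / 2 := by positivity
  have hmk := measurable_poissonDeriv_right hα hf k (t / 2)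
  have h1 := abs_poissonDeriv_le hα (hA _ ht2) (n - k) ht2
  have heq : poissonDeriv α n t f =ᵐ[laguerreMeasure α]
      poissonDeriv α (n - k) (t / 2) (poissonDeriv α k (t / 2) f) := by
    refine ae_eq_of_coeff_eq hα
      (memLp_of_ae_bound hα (measurable_poissonDeriv_right hα hf n t)
        (abs_poissonDeriv_le hα hM n ht) 2)
      (memLp_of_ae_bound hα (measurable_poissonDeriv_right hα hmk (n - k) (t / 2)) h1 2)
      fun l => ?_
    rw [coeff_poissonDeriv hα hf hM n ht, coeff_poissonDeriv hα hmk (hA _ ht2) _ ht2,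
      coeff_poissonDeriv hα hf hM k ht2]
    have e1 : (-√(∑ i, l i : ℕ)) ^ n = (-√(∑ i, l i : ℕ)) ^ (n - k) * (-√(∑ i, l i : ℕ)) ^ k := by
      rw [← pow_add, Nat.sub_add_cancel hkn]
    have e2 : Real.exp (-(√(∑ i, l i : ℕ) * t)) = Real.exp (-(√(∑ i, l i : ℕ) * (t / 2))) *
        Real.exp (-(√(∑ i, l i : ℕ) * (t / 2))) := by
      rw [← Real.exp_add]; congr 1; ring
    rw [e1, e2]
    ring
  filter_upwards [heq, h1] with x hx1 hx2
  rw [hx1]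
  refine hx2.trans_eq ?_
  have e3 : ((t / 2) ^ (n - k))⁻¹ = (t / 2) ^ (-((n : ℝ) - k)) := by
    rw [Real.rpow_neg ht2.le, ← Nat.cast_sub hkn, Real.rpow_natCast]
  have e4 : (t / 2) ^ (-((n : ℝ) - k)) * (t / 2) ^ (-(k : ℝ) + β) =
      2 ^ ((n : ℝ) - β) * t ^ (-(n : ℝ) + β) := by
    rw [← Real.rpow_add ht2, show -((n : ℝ) - k) + (-(k : ℝ) + β) = -(n : ℝ) + β by ring,
      Real.div_rpow ht.le (by norm_num), show -(n : ℝ) + β = -((n : ℝ) - β) by ring,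
      Real.rpow_neg (by norm_num : (0 : ℝ) ≤ 2)]
    field_simp
  rw [e3]
  linear_combination (subConst (n - k) * A) * e4

/-! ### The Lipschitz condition -/

lemma eLpNorm_top_le_iff {μ : Measure (Fin d → ℝ)} {g : (Fin d → ℝ) → ℝ} {A : ℝ} (hA : 0 ≤ A) :
    eLpNorm g ⊤ μ ≤ ENNReal.ofReal A ↔ ∀ᵐ x ∂μ, |g x| ≤ A := by
  rw [eLpNorm_exponent_top]
  constructor
  · intro h
    filter_upwards [ae_le_eLpNormEssSup (f := g) (μ := μ)] with x hx
    have := hx.trans h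
    rw [← ofReal_norm] at this
    exact (ENNReal.ofReal_le_ofReal_iff hA).mp this
  · exact fun h => eLpNormEssSup_le_of_ae_bound h

lemma laguerreLipBound_iff (hα : ∀ i, -1 < α i) (hf : Measurable f)
    (hM : ∀ᵐ y ∂(laguerreMeasure α), |f y| ≤ M) {β A : ℝ} :
    LaguerreLipBound α β f A ↔ 0 ≤ A ∧ ∀ t, 0 < t → ∀ᵐ x ∂(laguerreMeasure α),
      |poissonDeriv α (lipOrder β) t f x| ≤ A * t ^ (-(lipOrder β : ℝ) + β) := by
  unfold LaguerreLipBound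
  refine and_congr_right fun hA => forall_congr' fun t => imp_congr_right fun ht => ?_
  rw [eLpNorm_top_le_iff (mul_nonneg hA (Real.rpow_nonneg ht.le _))]
  refine Filter.eventually_congr ?_
  filter_upwards [ae_pos hα] with x hx
  rw [iteratedDeriv_laguerrePoisson hα hf hM _ ht hx]

lemma lt_lipOrder (β : ℝ) : β < lipOrder β := by
  unfold lipOrder
  push_cast
  exact Nat.lt_floor_add_one β

lemma lipOrder_mono {β γ : ℝ} (h : β ≤ γ) : lipOrder β ≤ lipOrder γ := by
  unfold lipOrder
  exact Nat.add_le_add_right (Nat.floor_mono h) 1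

lemma integrableOn_rpow_mul_add_rpow {l p : ℝ} (hl : 0 < l) (hp : l < p) :
    IntegrableOn (fun v : ℝ => v ^ (l - 1) * (1 + v) ^ (-p)) (Ioi 0) := by
  have hm : Measurable fun v : ℝ => v ^ (l - 1) * (1 + v) ^ (-p) := by fun_prop
  rw [← Ioc_union_Ioi_eq_Ioi zero_le_one]
  refine IntegrableOn.union ?_ ?_
  · have h : IntegrableOn (fun v : ℝ => v ^ (l - 1)) (Ioc 0 1) := by
      rw [← intervalIntegrable_iff_integrableOn_Ioc_of_le zero_le_one]
      exact intervalIntegral.intervalIntegrable_rpow' (by linarith)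
    refine Integrable.mono' h hm.aestronglyMeasurable ?_
    filter_upwards [ae_restrict_mem measurableSet_Ioc] with v hv
    have hv0 : 0 < v := hv.1
    rw [Real.norm_of_nonneg (by positivity)]
    exact mul_le_of_le_one_right (by positivity)
      (Real.rpow_le_one_of_one_le_of_nonpos (by linarith) (by linarith))
  · have h : IntegrableOn (fun v : ℝ => v ^ (l - 1 - p)) (Ioi 1) :=
      integrableOn_Ioi_rpow_of_lt (by linarith) one_pos
    refine Integrable.mono' h hm.aestronglyMeasurable ?_
    filter_upwards [ae_restrict_mem measurableSet_Ioi] with v hv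
    have hv0 : 0 < v := lt_trans one_pos hv
    rw [Real.norm_of_nonneg (by positivity), sub_eq_add_neg (l - 1), Real.rpow_add hv0]
    exact mul_le_mul_of_nonneg_left
      (Real.rpow_le_rpow_of_nonpos hv0 (by linarith) (by linarith)) (by positivity)

lemma rpow_scaling {l p t v : ℝ} (ht : 0 < t) (hv : 0 < v) :
    (t * v) ^ (l - 1) * (t + t * v) ^ (-p) =
      t ^ (l - 1 - p) * (v ^ (l - 1) * (1 + v) ^ (-p)) := by
  rw [show t + t * v = t * (1 + v) by ring, Real.mul_rpow ht.le hv.le,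
    Real.mul_rpow ht.le (by positivity), sub_eq_add_neg (l - 1) p, Real.rpow_add ht]
  ring

lemma integrableOn_rpow_mul_add_rpow' {l p t : ℝ} (hl : 0 < l) (hp : l < p) (ht : 0 < t) :
    IntegrableOn (fun s : ℝ => s ^ (l - 1) * (t + s) ^ (-p)) (Ioi 0) := by
  have h := integrableOn_Ioi_comp_mul_left_iff
    (fun s : ℝ => s ^ (l - 1) * (t + s) ^ (-p)) 0 ht
  rw [mul_zero] at h
  rw [← h]
  refine IntegrableOn.congr_fun ((integrableOn_rpow_mul_add_rpow hl hp).const_mul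
    (t ^ (l - 1 - p))) (fun v hv => ?_) measurableSet_Ioi
  exact (rpow_scaling ht hv).symm

lemma integral_rpow_mul_add_rpow {l p t : ℝ} (ht : 0 < t) :
    ∫ s in Ioi (0 : ℝ), s ^ (l - 1) * (t + s) ^ (-p) =
      t ^ (l - p) * ∫ v in Ioi (0 : ℝ), v ^ (l - 1) * (1 + v) ^ (-p) := by
  have h := integral_comp_mul_left_Ioi (fun s : ℝ => s ^ (l - 1) * (t + s) ^ (-p)) 0 ht
  rw [mul_zero, setIntegral_congr_fun measurableSet_Ioi (fun v hv => rpow_scaling ht hv),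
    integral_const_mul, smul_eq_mul] at h
  have e : t ^ (l - p) = t * t ^ (l - 1 - p) := by
    rw [show l - p = 1 + (l - 1 - p) by ring, Real.rpow_add ht, Real.rpow_one]
  rw [e, mul_assoc, h]
  field_simp

/-- Regularity gained from a multiplier `m(√L)` whose symbol is, off the constants, the Laplace
transform of a kernel `κ` with `|κ(s)| ≤ B s^{lam-1}`: the `n`-th time derivative of the Poisson
semigroup on `m(√L) f` is `∫ κ(s) ∂_t^n P_{t+s} f ds`. -/
theorem laguerreLipBound_of_multiplier (hα : ∀ i, -1 < α i) {β lam : ℝ} (hβ : 0 < β)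
    (hlam : 0 < lam) {κ : ℝ → ℝ} (hκ : Measurable κ) {B : ℝ}
    (hB : ∀ s, 0 < s → |κ s| ≤ B * s ^ (lam - 1)) {m : ℕ → ℝ}
    (hm : ∀ j : ℕ, 1 ≤ j → ∫ s in Ioi (0 : ℝ), κ s * Real.exp (-(√j * s)) = m j) :
    ∃ C : ℝ, 0 ≤ C ∧ ∀ f g : (Fin d → ℝ) → ℝ, Measurable f → Measurable g →
      ∀ M N : ℝ, (∀ᵐ y ∂(laguerreMeasure α), |f y| ≤ M) →
      (∀ᵐ y ∂(laguerreMeasure α), |g y| ≤ N) →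
      (∀ k : Fin d → ℕ, ∫ x, g x * laguerrePolyProd α k x ∂(laguerreMeasure α) =
        m (∑ i, k i) * ∫ x, f x * laguerrePolyProd α k x ∂(laguerreMeasure α)) →
      ∀ A, LaguerreLipBound α β f A → LaguerreLipBound α (β + lam) g (C * A) := by
  set k := lipOrder β with hk
  set n := lipOrder (β + lam) with hn
  have hkn : k ≤ n := lipOrder_mono (by linarith)
  have hn1 : β + lam < n := lt_lipOrder _
  have hn0 : n ≠ 0 := by rintro h; rw [h] at hn1; simp at hn1; linarith
  set C₁ := subConst (n - k) * 2 ^ ((n : ℝ) - β) with hC₁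
  have hC₁0 : 0 ≤ C₁ := mul_nonneg (subConst_nonneg _) (by positivity)
  set I₀ := ∫ v in Ioi (0 : ℝ), v ^ (lam - 1) * (1 + v) ^ (-((n : ℝ) - β)) with hI₀
  have hI₀0 : 0 ≤ I₀ := setIntegral_nonneg measurableSet_Ioi fun v hv => by
    have : 0 < v := hv
    positivity
  have hB0 : 0 ≤ B := by simpa using (abs_nonneg _).trans (hB 1 one_pos)
  refine ⟨B * C₁ * I₀, by positivity, fun f g hf hg M N hM hN hcoeff A hA => ?_⟩
  rw [laguerreLipBound_iff hα hf hM] at hA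
  rw [laguerreLipBound_iff hα hg hN]
  obtain ⟨hA0, hA⟩ := hA
  refine ⟨by positivity, fun t ht => ?_⟩
  set U : ℝ → (Fin d → ℝ) → ℝ := fun s x => κ s * poissonDeriv α n (t + s) f x with hU
  set D : ℝ → ℝ := fun s => B * C₁ * A * (s ^ (lam - 1) * (t + s) ^ (-((n : ℝ) - β))) with hD
  have hUm : Measurable (Function.uncurry U) := by
    have h2 : Measurable fun q : ℝ × (Fin d → ℝ) => (t + q.1, q.2) := by fun_prop
    have h3 := (measurable_poissonDeriv hα hf n).comp h2
    refine Measurable.mul (by fun_prop) ?_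
    exact h3
  have hDm : Measurable D := by fun_prop
  have hDi : Integrable D (volume.restrict (Ioi 0)) :=
    (integrableOn_rpow_mul_add_rpow' hlam (by linarith) ht).const_mul _
  have hb : ∀ᵐ s ∂(volume.restrict (Ioi (0 : ℝ))), ∀ᵐ x ∂(laguerreMeasure α),
      |U s x| ≤ D s := by
    filter_upwards [ae_restrict_mem measurableSet_Ioi] with s hs
    have hs : 0 < s := hs
    filter_upwards [abs_poissonDeriv_le_of_le hα hf hM hkn hA (t := t + s) (by positivity)]
      with x hx
    simp only [hU, hD, abs_mul]
    refine (mul_le_mul (hB s hs) hx (abs_nonneg _) (by positivity)).trans_eq ?_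
    rw [show -(n : ℝ) + β = -((n : ℝ) - β) by ring]
    ring
  have heq : poissonDeriv α n t g =ᵐ[laguerreMeasure α]
      fun x => ∫ s in Ioi (0 : ℝ), U s x := by
    refine ae_eq_of_coeff_eq hα
      (memLp_of_ae_bound hα (measurable_poissonDeriv_right hα hg n t)
        (abs_poissonDeriv_le hα hN n ht) 2)
      (memLp_of_ae_bound hα (measurable_integral_left hUm)
        (ae_abs_integral_le hα hUm hDm hDi hb) 2) fun l => ?_
    rw [coeff_poissonDeriv hα hg hN n ht, hcoeff, coeff_integral hα hUm hDi hb]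
    -- for the constants both sides vanish since `n ≠ 0`, whatever the value of `m 0`
    rcases Nat.eq_zero_or_pos (∑ i, l i) with h0 | h0
    · rw [h0]
      rw [setIntegral_congr_fun (g := fun _ => 0) measurableSet_Ioi fun s hs => ?_]
      · simp [hn0]
      have hs : 0 < s := hs
      simp only [hU, mul_assoc]
      rw [integral_const_mul, coeff_poissonDeriv hα hf hM n (by positivity), h0]
      simp [hn0]
    · rw [← hm _ h0, ← integral_mul_const, ← integral_const_mul]
      refine setIntegral_congr_fun measurableSet_Ioi fun s hs => ?_
      have hs : 0 < s := hs
      simp only [hU, mul_assoc]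
      rw [integral_const_mul, coeff_poissonDeriv hα hf hM n (by positivity)]
      rw [mul_add, neg_add, Real.exp_add]
      ring
  filter_upwards [heq, ae_abs_integral_le hα hUm hDm hDi hb] with x hx1 hx2
  rw [hx1]
  refine hx2.trans_eq ?_
  simp only [hD]
  rw [integral_const_mul, integral_rpow_mul_add_rpow ht,
    show lam - ((n : ℝ) - β) = -(n : ℝ) + (β + lam) by ring]
  ring

end

/-! ### The kernel of the Bessel potential -/

/-- The moment generating function of a Gamma law, continued to a complex half-plane. -/
lemma complexMGF_gammaMeasure {a : ℝ} (ha : 0 < a) {z : ℂ} (hz : z.re < 1) :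
    ProbabilityTheory.complexMGF id (ProbabilityTheory.gammaMeasure a 1) z =
      (1 - z) ^ (-(a : ℂ)) := by
  have ha' : -1 < a - 1 := by linarith
  have hG : 0 < Gamma a := Gamma_pos_of_pos ha
  have hexp : ∀ s : ℝ, s < 1 → Integrable (fun x : ℝ => Real.exp (s * x))
      (ProbabilityTheory.gammaMeasure a 1) ∧
      ∫ x, Real.exp (s * x) ∂(ProbabilityTheory.gammaMeasure a 1) = (1 - s) ^ (-a) := by
    intro s hs
    have h1 := integrable_pow_mul_exp (b := -s) ha' (by linarith) 0
    have h2 := integral_pow_mul_exp (b := -s) ha' (by linarith) 0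
    have hs' : 0 ≤ 1 - s := by linarith
    simp only [sub_add_cancel, pow_zero, one_mul, neg_mul, neg_neg, CharP.cast_eq_zero, zero_add,
      ← sub_eq_add_neg, div_self hG.ne', one_div] at h1 h2
    exact ⟨h1, by rw [h2, Real.inv_rpow hs', Real.rpow_neg hs']⟩
  have hU : ∀ z : ℂ, z ∈ {z : ℂ | z.re ∈ Iio (1 : ℝ)} → z.re ∈ interior
      (ProbabilityTheory.integrableExpSet id (ProbabilityTheory.gammaMeasure a 1)) := fun z hz =>
    interior_maximal (fun s hs => (hexp s hs).1) isOpen_Iio hz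
  have hA₁ : AnalyticOnNhd ℂ
      (ProbabilityTheory.complexMGF id (ProbabilityTheory.gammaMeasure a 1))
      {z : ℂ | z.re ∈ Iio (1 : ℝ)} := fun z hz => ProbabilityTheory.analyticAt_complexMGF (hU z hz)
  have hA₂ : AnalyticOnNhd ℂ (fun z : ℂ => (1 - z) ^ (-(a : ℂ))) {z : ℂ | z.re ∈ Iio (1 : ℝ)} := by
    intro z hz
    refine AnalyticAt.cpow (by fun_prop) analyticAt_const (Or.inl ?_)
    simpa using hz
  have hpre : IsPreconnected {z : ℂ | z.re ∈ Iio (1 : ℝ)} :=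
    ((convex_Iio (1 : ℝ)).linear_preimage Complex.reLm).isPreconnected
  refine hA₁.eqOn_of_preconnected_of_frequently_eq hA₂ hpre (z₀ := 0) (by simp) ?_ hz
  have hreal : ∃ᶠ s : ℝ in 𝓝[≠] 0,
      ProbabilityTheory.complexMGF id (ProbabilityTheory.gammaMeasure a 1) (s : ℂ) =
        (1 - (s : ℂ)) ^ (-(a : ℂ)) := by
    refine Eventually.frequently ?_
    filter_upwards [nhdsWithin_le_nhds (Iio_mem_nhds one_pos)] with s hs
    have hs : s < 1 := hs
    rw [ProbabilityTheory.complexMGF_ofReal, ProbabilityTheory.mgf]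
    simp only [id]
    rw [(hexp s hs).2, Complex.ofReal_cpow (by linarith)]
    push_cast
    rfl
  have ht : Tendsto (fun s : ℝ => (s : ℂ)) (𝓝[≠] 0) (𝓝[≠] 0) := by
    refine tendsto_nhdsWithin_iff.mpr ⟨?_, ?_⟩
    · exact (Complex.continuous_ofReal.tendsto' 0 0 (by simp)).mono_left nhdsWithin_le_nhds
    · filter_upwards [self_mem_nhdsWithin] with s hs
      simpa using hs
  exact ht.frequently hreal

/-- The function `t^{a-1} e^{-zt}` on the half-line. -/
noncomputable def powExp (a : ℝ) (z : ℂ) (t : ℝ) : ℂ :=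
  ((t ^ (a - 1) : ℝ) : ℂ) * Complex.exp (-(z * t))

lemma norm_powExp {a : ℝ} {z : ℂ} {t : ℝ} (ht : 0 ≤ t) :
    ‖powExp a z t‖ = t ^ (a - 1) * Real.exp (-(z.re * t)) := by
  unfold powExp
  rw [norm_mul, Complex.norm_real, Real.norm_of_nonneg (Real.rpow_nonneg ht _), Complex.norm_exp]
  simp

lemma measurable_powExp (a : ℝ) (z : ℂ) : Measurable (powExp a z) := by
  unfold powExp
  fun_prop

lemma integrableOn_powExp {a : ℝ} (ha : 0 < a) {z : ℂ} (hz : 0 < z.re) :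
    IntegrableOn (powExp a z) (Ioi 0) := by
  refine Integrable.mono' (integrableOn_rpow_mul_exp ha hz)
    (measurable_powExp a z).aestronglyMeasurable ?_
  filter_upwards [ae_restrict_mem measurableSet_Ioi] with t ht
  exact (norm_powExp (le_of_lt ht)).le

/-- Euler's integral with a complex rate. -/
lemma integral_powExp {a : ℝ} (ha : 0 < a) {z : ℂ} (hz : 0 < z.re) :
    ∫ t in Ioi (0 : ℝ), powExp a z t = Gamma a * z ^ (-(a : ℂ)) := by
  have hG : 0 < Gamma a := Gamma_pos_of_pos ha
  have h := complexMGF_gammaMeasure ha (z := 1 - z) (by simpa using hz)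
  rw [sub_sub_cancel] at h
  rw [← h, ProbabilityTheory.complexMGF]
  have hgm := gammaMeasure_eq (a := a - 1)
  rw [sub_add_cancel] at hgm
  rw [hgm, integral_withDensity_eq_integral_toReal_smul (by fun_prop) (by simp),
    ← integral_const_mul]
  refine setIntegral_congr_fun measurableSet_Ioi fun t ht => ?_
  have ht : 0 < t := ht
  simp only [id, powExp]
  rw [ENNReal.toReal_ofReal (by positivity), Complex.real_smul]
  have hG' : (Gamma a : ℂ) ≠ 0 := by exact_mod_cast hG.ne'
  push_cast
  rw [show -(z * (t : ℂ)) = -(t : ℂ) + (1 - z) * t by ring, Complex.exp_add]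
  field_simp

/-- Up to the factor `Γ(a)^{-2}`, the function whose Laplace transform is `(1 + ξ²)^{-a}`: the
convolution of `t^{a-1} e^{-it}` and `t^{a-1} e^{it}`. It is real, and the real part is taken
only to have a real-valued function. -/
noncomputable def besselKernel (a s : ℝ) : ℝ :=
  (Gamma a ^ 2)⁻¹ * (∫ t, ({p : ℝ × ℝ | 0 < p.2 ∧ p.2 ≤ p.1}.indicator
    (fun p => powExp a Complex.I p.2 * powExp a (-Complex.I) (p.1 - p.2)) (s, t))).re

lemma measurable_besselKernel (a : ℝ) : Measurable (besselKernel a) := by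
  unfold besselKernel
  have h1 := measurable_powExp a Complex.I
  have h2 := measurable_powExp a (-Complex.I)
  have hS : MeasurableSet {p : ℝ × ℝ | 0 < p.2 ∧ p.2 ≤ p.1} :=
    (measurableSet_lt measurable_const measurable_snd).inter
      (measurableSet_le measurable_snd measurable_fst)
  have h3 : Measurable ({p : ℝ × ℝ | 0 < p.2 ∧ p.2 ≤ p.1}.indicator
    (fun p => powExp a Complex.I p.2 * powExp a (-Complex.I) (p.1 - p.2))) := by
    refine Measurable.indicator ?_ hS
    fun_prop
  have h4 := (h3.stronglyMeasurable.integral_prod_right' (ν := volume)).measurable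
  exact (Complex.measurable_re.comp h4).const_mul _

lemma besselKernel_eq {a s : ℝ} (hs : 0 < s) : besselKernel a s = (Gamma a ^ 2)⁻¹ *
    (∫ t in (0 : ℝ)..s, powExp a Complex.I t * powExp a (-Complex.I) (s - t)).re := by
  unfold besselKernel
  rw [intervalIntegral.integral_of_le hs.le, ← integral_indicator measurableSet_Ioc]
  congr 2

lemma abs_besselKernel_le {a : ℝ} {s : ℝ} (hs : 0 < s) :
    |besselKernel a s| ≤ ((Gamma a ^ 2)⁻¹ *
      ∫ u in (0 : ℝ)..1, u ^ (a - 1) * (1 - u) ^ (a - 1)) * s ^ (2 * a - 1) := by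
  rw [besselKernel_eq hs, abs_mul, abs_of_nonneg (by positivity), mul_assoc]
  refine mul_le_mul_of_nonneg_left ?_ (by positivity)
  refine (Complex.abs_re_le_norm _).trans ?_
  refine (intervalIntegral.norm_integral_le_integral_norm hs.le).trans_eq ?_
  have h1 : ∫ t in (0 : ℝ)..s, ‖powExp a Complex.I t * powExp a (-Complex.I) (s - t)‖ =
      ∫ t in (0 : ℝ)..s, t ^ (a - 1) * (s - t) ^ (a - 1) := by
    refine intervalIntegral.integral_congr fun t ht => ?_
    rw [uIcc_of_le hs.le] at ht
    simp only [norm_mul]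
    rw [norm_powExp ht.1, norm_powExp (by linarith [ht.2])]
    simp
  have h2 := intervalIntegral.mul_integral_comp_mul_left (a := 0) (b := 1)
    (f := fun t : ℝ => t ^ (a - 1) * (s - t) ^ (a - 1)) s
  simp only [mul_zero, mul_one] at h2
  rw [h1, ← h2]
  have h3 : ∀ u ∈ uIcc (0 : ℝ) 1, (s * u) ^ (a - 1) * (s - s * u) ^ (a - 1) =
      s ^ (2 * a - 2) * (u ^ (a - 1) * (1 - u) ^ (a - 1)) := by
    intro u hu
    rw [uIcc_of_le zero_le_one] at hu
    rw [show s - s * u = s * (1 - u) by ring, Real.mul_rpow hs.le hu.1,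
      Real.mul_rpow hs.le (by linarith [hu.2]), show 2 * a - 2 = (a - 1) + (a - 1) by ring,
      Real.rpow_add hs]
    ring
  rw [intervalIntegral.integral_congr h3, intervalIntegral.integral_const_mul,
    show 2 * a - 1 = 1 + (2 * a - 2) by ring, Real.rpow_add hs, Real.rpow_one]
  ring

lemma laplace_besselKernel {a : ℝ} (ha : 0 < a) {ξ : ℝ} (hξ : 0 < ξ) :
    ∫ s in Ioi (0 : ℝ), besselKernel a s * Real.exp (-(ξ * s)) = (1 + ξ ^ 2) ^ (-a) := by
  have hG : 0 < Gamma a := Gamma_pos_of_pos ha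
  set z : ℂ := ξ + Complex.I with hz
  set z' : ℂ := ξ - Complex.I with hz'
  have hzre : 0 < z.re := by simp [hz, hξ]
  have hzre' : 0 < z'.re := by simp [hz', hξ]
  have hi := integrableOn_powExp ha hzre
  have hi' := integrableOn_powExp ha hzre'
  have hconv := integral_posConvolution hi hi' (ContinuousLinearMap.mul ℝ ℂ)
  have hconvi := integrable_posConvolution hi hi' (ContinuousLinearMap.mul ℝ ℂ)
  simp only [ContinuousLinearMap.mul_apply'] at hconv
  rw [integral_powExp ha hzre, integral_powExp ha hzre'] at hconv
  have hpt : ∀ s ∈ Ioi (0 : ℝ), besselKernel a s * Real.exp (-(ξ * s)) =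
      (Gamma a ^ 2)⁻¹ * (∫ t in (0 : ℝ)..s, powExp a z t * powExp a z' (s - t)).re := by
    intro s hs
    rw [besselKernel_eq hs, mul_assoc]
    congr 1
    have : ∀ t, powExp a z t * powExp a z' (s - t) = (powExp a Complex.I t *
        powExp a (-Complex.I) (s - t)) * ((Real.exp (-(ξ * s)) : ℝ) : ℂ) := by
      intro t
      have e : Complex.exp (-(z * t)) * Complex.exp (-(z' * ((s - t : ℝ) : ℂ))) =
          Complex.exp (-(Complex.I * t)) * Complex.exp (-(-Complex.I * ((s - t : ℝ) : ℂ))) *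
          Complex.exp (-(ξ * s)) := by
        rw [← Complex.exp_add, ← Complex.exp_add, ← Complex.exp_add]
        congr 1
        rw [hz, hz']
        push_cast
        ring
      unfold powExp
      push_cast at e ⊢
      linear_combination (((t ^ (a - 1) : ℝ) : ℂ) * (((s - t) ^ (a - 1) : ℝ) : ℂ)) * e
    simp_rw [this]
    rw [intervalIntegral.integral_mul_const, Complex.re_mul_ofReal]
  rw [setIntegral_congr_fun measurableSet_Ioi hpt, integral_const_mul]
  have hint : IntegrableOn (fun s : ℝ => ∫ t in (0 : ℝ)..s, powExp a z t * powExp a z' (s - t))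
      (Ioi 0) := by
    have h := hconvi.integrableOn (s := Ioi 0)
    refine h.congr_fun (fun s hs => ?_) measurableSet_Ioi
    simp [posConvolution, indicator_of_mem hs]
  have hre := integral_re hint
  simp only [RCLike.re_eq_complex_re] at hre
  rw [hre, hconv]
  have hconj : z' = (starRingEnd ℂ) z := by simp [hz, hz', sub_eq_add_neg]
  have harg : z.arg ≠ Real.pi := by
    have := Complex.abs_arg_lt_pi_div_two_iff.mpr (Or.inl hzre)
    intro h
    rw [h, abs_of_pos Real.pi_pos] at this
    linarith [Real.pi_pos]
  have h1 : z' ^ (-(a : ℂ)) = (starRingEnd ℂ) (z ^ (-(a : ℂ))) := by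
    rw [hconj, Complex.conj_cpow _ _ harg]
    simp
  rw [h1, mul_mul_mul_comm, Complex.mul_conj, Complex.normSq_eq_norm_sq,
    show -(a : ℂ) = ((-a : ℝ) : ℂ) by push_cast; rfl, Complex.norm_cpow_real]
  have h2 : ‖z‖ ^ 2 = 1 + ξ ^ 2 := by
    rw [← Complex.normSq_eq_norm_sq, Complex.normSq_apply]
    simp [hz]
    ring
  rw [← h2, ← Real.rpow_natCast (‖z‖ ^ (-a)), ← Real.rpow_mul (norm_nonneg _),
    mul_comm (-a), Real.rpow_mul (norm_nonneg _), Real.rpow_natCast, ← Complex.ofReal_mul,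
    ← Complex.ofReal_mul, Complex.ofReal_re]
  field_simp

section
variable {d : ℕ} {α : Fin d → ℝ} {f g : (Fin d → ℝ) → ℝ}

/-! ### Norm estimates -/

/-- The heat semigroup depends only on the class of `f` modulo almost everywhere equality, but is
defined at every point. -/
lemma laguerreHeat_congr (hfg : f =ᵐ[laguerreMeasure α] g) (t : ℝ) :
    laguerreHeat α t f = laguerreHeat α t g := by
  funext x
  unfold laguerreHeat
  refine integral_congr_ae ?_
  filter_upwards [hfg] with y hy
  rw [hy]

lemma laguerrePoisson_congr (hfg : f =ᵐ[laguerreMeasure α] g) (t : ℝ) :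
    laguerrePoisson α t f = laguerrePoisson α t g := by
  funext x
  unfold laguerrePoisson
  simp_rw [laguerreHeat_congr hfg]

lemma laguerreLipBound_congr (hfg : f =ᵐ[laguerreMeasure α] g) (β A : ℝ) :
    LaguerreLipBound α β f A ↔ LaguerreLipBound α β g A := by
  unfold LaguerreLipBound
  simp_rw [laguerrePoisson_congr hfg]

lemma coeff_congr (hfg : f =ᵐ[laguerreMeasure α] g) (k : Fin d → ℕ) :
    ∫ x, f x * laguerrePolyProd α k x ∂(laguerreMeasure α) =
      ∫ x, g x * laguerrePolyProd α k x ∂(laguerreMeasure α) := by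
  refine integral_congr_ae ?_
  filter_upwards [hfg] with y hy
  rw [hy]

/-- A bounded function has a measurable representative, bounded by its essential supremum. -/
lemma exists_measurable_rep (hf : MemLp f ⊤ (laguerreMeasure α)) :
    ∃ f' : (Fin d → ℝ) → ℝ, Measurable f' ∧ f =ᵐ[laguerreMeasure α] f' ∧
      ∀ᵐ y ∂(laguerreMeasure α), |f' y| ≤ (eLpNorm f ⊤ (laguerreMeasure α)).toReal := by
  refine ⟨hf.1.mk f, hf.1.stronglyMeasurable_mk.measurable, hf.1.ae_eq_mk, ?_⟩
  have h : eLpNorm f ⊤ (laguerreMeasure α) ≤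
      ENNReal.ofReal (eLpNorm f ⊤ (laguerreMeasure α)).toReal :=
    (ENNReal.ofReal_toReal hf.2.ne).ge
  filter_upwards [(eLpNorm_top_le_iff ENNReal.toReal_nonneg).mp h, hf.1.ae_eq_mk] with y h1 h2
  rwa [← h2]

lemma laguerreLipNorm_le {β γ C₀ C₁ : ℝ} (hC₀ : 0 ≤ C₀) (hC₁ : 0 ≤ C₁)
    (hf : MemLaguerreLip α β f)
    (hg : (eLpNorm g ⊤ (laguerreMeasure α)).toReal ≤
      C₀ * (eLpNorm f ⊤ (laguerreMeasure α)).toReal)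
    (hA : ∀ A, LaguerreLipBound α β f A → LaguerreLipBound α γ g (C₁ * A)) :
    laguerreLipNorm α γ g ≤ (C₀ + C₁ + 1) * laguerreLipNorm α β f := by
  unfold laguerreLipNorm
  have hne : {A : ℝ | LaguerreLipBound α β f A}.Nonempty := hf.2
  have hbdd : BddBelow {A : ℝ | LaguerreLipBound α γ g A} := ⟨0, fun A hA => hA.1⟩
  have h1 : sInf {A : ℝ | LaguerreLipBound α γ g A} ≤
      C₁ * sInf {A : ℝ | LaguerreLipBound α β f A} := by
    rw [← smul_eq_mul, ← Real.sInf_smul_of_nonneg hC₁]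
    refine le_csInf (hne.smul_set) ?_
    rintro _ ⟨A, hA', rfl⟩
    exact csInf_le hbdd (hA A hA')
  have h2 : 0 ≤ sInf {A : ℝ | LaguerreLipBound α β f A} := Real.sInf_nonneg fun A hA => hA.1
  have h3 : 0 ≤ (eLpNorm f ⊤ (laguerreMeasure α)).toReal := ENNReal.toReal_nonneg
  nlinarith [mul_nonneg hC₀ h2, mul_nonneg hC₁ h3]

lemma toReal_eLpNorm_top_le {A : ℝ} (hA : 0 ≤ A)
    (h : ∀ᵐ x ∂(laguerreMeasure α), |g x| ≤ A) :
    (eLpNorm g ⊤ (laguerreMeasure α)).toReal ≤ A :=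
  ENNReal.toReal_le_of_le_ofReal hA ((eLpNorm_top_le_iff hA).mpr h)

/-! ### The two potentials of a bounded function -/

lemma integrable_weight {l : ℝ} (hl : 0 < l) :
    IntegrableOn (fun s : ℝ => s ^ (l - 1) * Real.exp (-s)) (Ioi 0) := by
  simpa using integrableOn_rpow_mul_exp hl one_pos

lemma integral_weight_mul_exp {l c : ℝ} (hl : 0 < l) (hc : 0 ≤ c) :
    ∫ s in Ioi (0 : ℝ), s ^ (l - 1) * Real.exp (-s) * Real.exp (-(c * s)) =
      Gamma l * (1 + c) ^ (-l) := by
  have h1c : 0 < 1 + c := by linarith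
  have h := Real.integral_rpow_mul_exp_neg_mul_Ioi hl h1c
  rw [one_div, Real.inv_rpow h1c.le, ← Real.rpow_neg h1c.le, mul_comm] at h
  rw [← h]
  refine setIntegral_congr_fun measurableSet_Ioi fun s _ => ?_
  rw [mul_assoc, ← Real.exp_add]
  ring_nf

/-- The Bessel–Laguerre potential as a superposition of the heat semigroup. -/
lemma exists_besselLaguerrePotential (hα : ∀ i, -1 < α i) {lam : ℝ} (hlam : 0 < lam)
    (hf : MemLp f ⊤ (laguerreMeasure α)) :
    ∃ g : (Fin d → ℝ) → ℝ, IsBesselLaguerrePotential α lam f g ∧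
      ∀ᵐ x ∂(laguerreMeasure α), |g x| ≤ (eLpNorm f ⊤ (laguerreMeasure α)).toReal := by
  obtain ⟨f', hfm, hff', hM⟩ := exists_measurable_rep hf
  set M := (eLpNorm f ⊤ (laguerreMeasure α)).toReal with hMdef
  have hl : 0 < lam / 2 := by positivity
  have hG := Gamma_pos_of_pos hl
  set w : ℝ → ℝ := fun s => (Gamma (lam / 2))⁻¹ * (s ^ (lam / 2 - 1) * Real.exp (-s)) with hw
  have hwm : Measurable w := by fun_prop
  have hU := measurable_comp_heat (τ := fun s => s) hα hfm hwm measurable_id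
  have hDi : Integrable (fun s => w s * M) (volume.restrict (Ioi 0)) :=
    ((integrable_weight hl).const_mul _).mul_const M
  have hb : ∀ᵐ s ∂(volume.restrict (Ioi (0 : ℝ))), ∀ᵐ x ∂(laguerreMeasure α),
      |w s * laguerreHeat α s f' x| ≤ w s * M := by
    filter_upwards [ae_restrict_mem measurableSet_Ioi] with s hs
    have hs : 0 < s := hs
    filter_upwards [ae_pos hα] with x hx
    have hw0 : 0 ≤ w s := by positivity
    rw [abs_mul, abs_of_nonneg hw0]
    exact mul_le_mul_of_nonneg_left (abs_laguerreHeat_le hα hM hs hx) hw0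
  have hw1 : ∫ s in Ioi (0 : ℝ), w s * M = M := by
    have h := integral_weight_mul_exp hl le_rfl
    simp only [zero_mul, neg_zero, Real.exp_zero, mul_one, add_zero, Real.one_rpow] at h
    rw [integral_mul_const, integral_const_mul, h, inv_mul_cancel₀ hG.ne', one_mul]
  have hbd := ae_abs_integral_le hα hU (by fun_prop) hDi hb
  rw [hw1] at hbd
  refine ⟨fun x => ∫ s in Ioi (0 : ℝ), w s * laguerreHeat α s f' x,
    ⟨memLp_of_ae_bound hα (measurable_integral_left hU) hbd 2, fun k => ?_⟩, hbd⟩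
  rw [coeff_integral hα hU hDi hb, coeff_congr hff']
  have h := integral_weight_mul_exp hl (Nat.cast_nonneg (α := ℝ) (∑ i, k i))
  have hpt : ∀ s ∈ Ioi (0 : ℝ), ∫ x, w s * laguerreHeat α s f' x * laguerrePolyProd α k x
      ∂(laguerreMeasure α) = (Gamma (lam / 2))⁻¹ * (s ^ (lam / 2 - 1) * Real.exp (-s) *
        Real.exp (-((∑ i, k i : ℕ) * s))) *
        ∫ x, f' x * laguerrePolyProd α k x ∂(laguerreMeasure α) := by
    intro s hs
    simp_rw [mul_assoc (w s)]
    rw [integral_const_mul, coeff_laguerreHeat hα hfm hM hs]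
    simp only [hw]
    ring
  rw [setIntegral_congr_fun measurableSet_Ioi hpt, integral_mul_const, integral_const_mul, h,
    inv_mul_cancel_left₀ hG.ne', neg_div]

/-- The potential built on the Poisson semigroup: absolute convergence, sup bound and symbol. -/
lemma poissonBesselPotential_spec (hα : ∀ i, -1 < α i) {lam : ℝ} (hlam : 0 < lam)
    (hf : MemLp f ⊤ (laguerreMeasure α)) :
    (∀ᵐ x ∂(laguerreMeasure α), IntegrableOn
      (fun s : ℝ => s ^ (lam - 1) * Real.exp (-s) * laguerrePoisson α s f x) (Ioi 0)) ∧
    Measurable (poissonBesselPotential α lam f) ∧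
    (∀ᵐ x ∂(laguerreMeasure α), |poissonBesselPotential α lam f x| ≤
      subConst 0 * (eLpNorm f ⊤ (laguerreMeasure α)).toReal) ∧
    IsLaguerreMultiplier α (fun n => (1 + √(n : ℝ)) ^ (-lam)) f
      (poissonBesselPotential α lam f) := by
  obtain ⟨f', hfm, hff', hM⟩ := exists_measurable_rep hf
  set M := (eLpNorm f ⊤ (laguerreMeasure α)).toReal with hMdef
  have hM0 : 0 ≤ M := ENNReal.toReal_nonneg
  have hG := Gamma_pos_of_pos hlam
  set w : ℝ → ℝ := fun s => s ^ (lam - 1) * Real.exp (-s) with hw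
  have hwm : Measurable w := by fun_prop
  have hU : Measurable (Function.uncurry fun s x => w s * laguerrePoisson α s f x) := by
    simp_rw [laguerrePoisson_congr hff', laguerrePoisson_eq]
    refine Measurable.mul (by fun_prop) ?_
    exact measurable_poissonDeriv hα hfm 0
  have hDi : Integrable (fun s => w s * (subConst 0 * M)) (volume.restrict (Ioi 0)) :=
    (integrable_weight hlam).mul_const _
  have hb : ∀ᵐ s ∂(volume.restrict (Ioi (0 : ℝ))), ∀ᵐ x ∂(laguerreMeasure α),
      |w s * laguerrePoisson α s f x| ≤ w s * (subConst 0 * M) := by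
    filter_upwards [ae_restrict_mem measurableSet_Ioi] with s hs
    have hs : 0 < s := hs
    filter_upwards [abs_poissonDeriv_le hα hM 0 hs] with x hx
    have hw0 : 0 ≤ w s := by positivity
    rw [laguerrePoisson_congr hff', laguerrePoisson_eq, abs_mul, abs_of_nonneg hw0]
    refine mul_le_mul_of_nonneg_left ?_ hw0
    simpa using hx
  have hDm : Measurable fun s => w s * (subConst 0 * M) := by fun_prop
  have hbd := ae_abs_integral_le hα hU hDm hDi hb
  have hw1 : ∫ s in Ioi (0 : ℝ), w s * (subConst 0 * M) = Gamma lam * (subConst 0 * M) := by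
    have h := integral_weight_mul_exp hlam le_rfl
    simp only [zero_mul, neg_zero, Real.exp_zero, mul_one, add_zero, Real.one_rpow] at h
    rw [integral_mul_const, h]
  have hmeas : Measurable (poissonBesselPotential α lam f) :=
    (measurable_integral_left hU).const_mul _
  have hbd' : ∀ᵐ x ∂(laguerreMeasure α), |poissonBesselPotential α lam f x| ≤
      subConst 0 * M := by
    filter_upwards [hbd] with x hx
    rw [hw1] at hx
    unfold poissonBesselPotential
    rw [abs_mul, abs_of_nonneg (by positivity), one_div, inv_mul_le_iff₀ hG]
    exact hx
  refine ⟨ae_integrable_of_bound hα hU hDm hDi hb, hmeas, hbd',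
    memLp_of_ae_bound hα hmeas hbd' 2, fun k => ?_⟩
  unfold poissonBesselPotential
  simp_rw [mul_assoc (1 / Gamma lam)]
  rw [integral_const_mul, coeff_integral hα hU hDi hb, coeff_congr hff']
  have h := integral_weight_mul_exp hlam (Real.sqrt_nonneg ((∑ i, k i : ℕ) : ℝ))
  have hpt : ∀ s ∈ Ioi (0 : ℝ), ∫ x, w s * laguerrePoisson α s f x * laguerrePolyProd α k x
      ∂(laguerreMeasure α) = s ^ (lam - 1) * Real.exp (-s) *
        Real.exp (-(√(∑ i, k i : ℕ) * s)) *
        ∫ x, f' x * laguerrePolyProd α k x ∂(laguerreMeasure α) := by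
    intro s hs
    simp_rw [mul_assoc (w s), laguerrePoisson_congr hff', laguerrePoisson_eq]
    rw [integral_const_mul, coeff_poissonDeriv hα hfm hM 0 hs]
    simp only [hw, pow_zero, one_mul]
    ring
  rw [setIntegral_congr_fun measurableSet_Ioi hpt, integral_mul_const, h]
  field_simp

end

end Laguerre

open Laguerre in
theorem theorem3p1 (d : ℕ) (α : Fin d → ℝ) (hα : ∀ i, -(1 / 2 : ℝ) < α i)
    (β lam : ℝ) (hβ : 0 < β) (hlam : 0 < lam) :
    (∃ C : ℝ, 0 < C ∧ ∀ f : (Fin d → ℝ) → ℝ, MemLaguerreLip α β f →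
      (∃ g : (Fin d → ℝ) → ℝ, IsBesselLaguerrePotential α lam f g) ∧
      ∀ g : (Fin d → ℝ) → ℝ, IsBesselLaguerrePotential α lam f g →
        MemLaguerreLip α (β + lam) g ∧
        laguerreLipNorm α (β + lam) g ≤ C * laguerreLipNorm α β f) ∧
    (∃ C : ℝ, 0 < C ∧ ∀ f : (Fin d → ℝ) → ℝ, MemLaguerreLip α β f →
      (∀ᵐ x ∂(laguerreMeasure α), IntegrableOn
        (fun s : ℝ => s ^ (lam - 1) * Real.exp (-s) * laguerrePoisson α s f x) (Set.Ioi 0)) ∧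
      IsLaguerreMultiplier α (fun n => (1 + √(n : ℝ)) ^ (-lam)) f
        (poissonBesselPotential α lam f) ∧
      MemLaguerreLip α (β + lam) (poissonBesselPotential α lam f) ∧
      laguerreLipNorm α (β + lam) (poissonBesselPotential α lam f)
        ≤ C * laguerreLipNorm α β f) := by
  have hα' : ∀ i, -1 < α i := fun i => by linarith [hα i]
  constructor
  · have hl : 0 < lam / 2 := by positivity
    obtain ⟨C, hC, key⟩ := laguerreLipBound_of_multiplier hα' hβ hlam
      (measurable_besselKernel (lam / 2))
      (fun s hs => by
        have h := abs_besselKernel_le (a := lam / 2) hs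
        rwa [mul_div_cancel₀ lam two_ne_zero] at h)
      (m := fun n => (1 + (n : ℝ)) ^ (-lam / 2)) (fun j hj => by
        have hj' : (0 : ℝ) < j := by exact_mod_cast hj
        rw [laplace_besselKernel hl (Real.sqrt_pos.mpr hj'), Real.sq_sqrt hj'.le, neg_div])
    refine ⟨1 + C + 1, by positivity, fun f hf => ?_⟩
    obtain ⟨g₀, hg₀, hb₀⟩ := exists_besselLaguerrePotential hα' hlam hf.1
    refine ⟨⟨g₀, hg₀⟩, fun g hg => ?_⟩
    -- the multiplier determines `g`, so the sup bound of the explicit potential passes to `g`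
    have hgg₀ : g =ᵐ[laguerreMeasure α] g₀ :=
      ae_eq_of_coeff_eq hα' hg.1 hg₀.1 fun k => by rw [hg.2 k, hg₀.2 k]
    have hbg : ∀ᵐ x ∂(laguerreMeasure α), |g x| ≤ (eLpNorm f ⊤ (laguerreMeasure α)).toReal := by
      filter_upwards [hgg₀, hb₀] with x h1 h2
      rwa [h1]
    have hgtop : MemLp g ⊤ (laguerreMeasure α) := memLp_top_of_bound hg.1.1 _ hbg
    obtain ⟨f', hfm, hff', hM⟩ := exists_measurable_rep hf.1
    obtain ⟨g', hgm, hgg', hN⟩ := exists_measurable_rep hgtop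
    have hA : ∀ A, LaguerreLipBound α β f A → LaguerreLipBound α (β + lam) g (C * A) := by
      intro A hA
      rw [laguerreLipBound_congr hgg']
      refine key f' g' hfm hgm _ _ hM hN (fun k => ?_) A ((laguerreLipBound_congr hff' β A).mp hA)
      rw [← coeff_congr hff', ← coeff_congr hgg']
      exact hg.2 k
    refine ⟨⟨hgtop, ?_⟩, laguerreLipNorm_le zero_le_one hC hf ?_ hA⟩
    · obtain ⟨A, hfA⟩ := hf.2
      exact ⟨C * A, hA A hfA⟩
    · rw [one_mul]
      exact toReal_eLpNorm_top_le ENNReal.toReal_nonneg hbg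
  · have hG := Real.Gamma_pos_of_pos hlam
    obtain ⟨C, hC, key⟩ := laguerreLipBound_of_multiplier hα' hβ hlam
      (κ := fun s => (Real.Gamma lam)⁻¹ * (s ^ (lam - 1) * Real.exp (-s))) (by fun_prop)
      (B := (Real.Gamma lam)⁻¹)
      (fun s hs => by
        rw [abs_of_nonneg (by positivity)]
        refine mul_le_mul_of_nonneg_left (mul_le_of_le_one_right (by positivity) ?_)
          (by positivity)
        rw [Real.exp_le_one_iff]
        linarith)
      (m := fun n => (1 + √(n : ℝ)) ^ (-lam)) (fun j _ => by
        simp_rw [mul_assoc (Real.Gamma lam)⁻¹]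
        rw [integral_const_mul, integral_weight_mul_exp hlam (Real.sqrt_nonneg _),
          inv_mul_cancel_left₀ hG.ne'])
    refine ⟨subConst 0 + C + 1, by linarith [subConst_nonneg 0], fun f hf => ?_⟩
    obtain ⟨hint, hgm, hN, hmult⟩ := poissonBesselPotential_spec hα' hlam hf.1
    obtain ⟨f', hfm, hff', hM⟩ := exists_measurable_rep hf.1
    have hA : ∀ A, LaguerreLipBound α β f A →
        LaguerreLipBound α (β + lam) (poissonBesselPotential α lam f) (C * A) := by
      intro A hA
      refine key f' _ hfm hgm _ _ hM hN (fun k => ?_) A ((laguerreLipBound_congr hff' β A).mp hA)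
      rw [← coeff_congr hff']
      exact hmult.2 k
    refine ⟨hint, hmult, ⟨memLp_of_ae_bound hα' hgm hN ⊤, ?_⟩,
      laguerreLipNorm_le (subConst_nonneg 0) hC hf ?_ hA⟩
    · obtain ⟨A, hfA⟩ := hf.2
      exact ⟨C * A, hA A hfA⟩
    · exact toReal_eLpNorm_top_le (mul_nonneg (subConst_nonneg 0) ENNReal.toReal_nonneg) hN
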